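/- Let $Y$ be a finite set of classes, $\Delta^Y$ the simplex of probability distributions on $Y$, and $X$ a measurable space. A hypothesis is a map $h\colon X\to\Delta^Y$; write $h(x)_y$ for the probability it assigns to $y$. Let $\ell\colon\Delta^Y\times Y\to[0,1]$ be a loss that is $L$-Lipschitz ($L\ge 0$) in the predicted probability of the observed label: $$|\ell(u,y)-\ell(v,y)|\le L\,|u_y-v_y|\qquad(u,v\in\Delta^Y,\ y\in Y).$$ (For two classes this says that $\ell(\cdot,y)$ is $L$-Lipschitz for the sup-norm on $\Delta^Y$.) There are $p$ clients. Client $k$ has a distribution $D_k$ on $X\times Y$ and $m_k$ examples drawn i.i.d. from $D_k$, independently across clients; $\widehat D_k$ is the corresponding empirical distribution and $m=\sum_{k=1}^p m_k$. For a distribution $D$ put $\mathcal L_D(h)=\mathbb E_{(x,y)\sim D}[\ell(h(x),y)]$. Let $\mathcal H_c$ (central) and $\mathcal H_l$ (local) be classes of measurable hypotheses, each containing a countable subclass of which every member of the class is the pointwise limit of a sequence. Let $d_c$ and $d_l$ be their pseudo-dimensions, where the pseudo-dimension of $\mathcal H$ is that of the class of real-valued functions $(x,y)\mapsto h(x)_y$,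 $h\in\mathcal H$: the largest $n$ for which there are $n$ distinct points $z_1,\dots,z_n\in X\times Y$ and thresholds $t_1,\dots,t_n\in\mathbb R$ such that every subset of $\{1,\dots,n\}$ has the form $\{i: f(z_i)>t_i\}$ for some $f$ in the class. Assume $d_c,d_l$ are finite, $d_l\ge 1$, $d_c\le m$ and $d_l\le m$. For $h_c\in\mathcal H_c$, $\bar h_l=(h_{l,1},\dots,h_{l,p})\in\mathcal H_l^p$ and $\bar\lambda\in[0,1]^p$ let $$F(h_c,\bar\lambda,\bar h_l)=\sum_{k=1}^p\frac{m_k}{m}\,\mathcal L_{D_k}\big((1-\lambda_k)h_c+\lambda_k h_{l,k}\big),$$ and let $\widehat F$ be the same expression with $\widehat D_k$ in place of $D_k$. Let $(h_c^*,\bar\lambda^*,\bar h_l^*)$ minimize $F$ over $\mathcal H_c\times[0,1]^p\times\mathcal H_l^p$, and let $0<\delta<1$. Then, with probability at least $1-\delta$ over the samples, every minimizer $(\widehat h_c^*,\widehat\lambda^*,\widehat h_l^*)$ of $\widehat F$ over $\mathcal H_c\times[0,1]^p\times\mathcal H_l^p$ satisfies $$F(\widehat h_c^*,\widehat\lambda^*,\widehat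 h_l^*)-F(h_c^*,\bar\lambda^*,\bar h_l^*)\le 2L\left(\sqrt{\frac{d_c}{m}\log\frac{em}{d_c}}+\sqrt{\frac{d_l\,p}{m}\log\frac{em}{d_l}}\right)+2\sqrt{\frac{\log(1/\delta)}{m}},$$ where the first square root is read as $0$ if $d_c=0$. (More precisely, the set of samples for which some minimizer of $\widehat F$ violates the inequality has outer probability at most $\delta$.) -/

import Mathlib

open MeasureTheory Filter Topology

noncomputable section

namespace ModelInterpolation

/-- A probabilistic classifier: it sends an input to a probability distribution over the
finite set `Y` of classes. -/
abbrev Hypothesis (X Y : Type*) [Fintype Y] := X → stdSimplex ℝ Y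

/-- A finite set `S` is pseudo-shattered by the class `F` of real-valued functions: there are
thresholds `t z` such that every subset `T` of `S` is cut out as `{z ∈ S | t z < f z}`
by some `f ∈ F`. -/
def PseudoShatters {Z : Type*} (F : Set (Z → ℝ)) (S : Finset Z) : Prop :=
  ∃ t : Z → ℝ, ∀ T ⊆ S, ∃ f ∈ F, ∀ z ∈ S, (t z < f z ↔ z ∈ T)

/-- The pseudo-dimension of a class of real-valued functions: the largest cardinality of a
pseudo-shattered finite set (`⊤` if there is no largest one). -/
def pseudoDim {Z : Type*} (F : Set (Z → ℝ)) : ℕ∞ :=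
  ⨆ S ∈ {S : Finset Z | PseudoShatters F S}, (S.card : ℕ∞)

/-- A class of classifiers, regarded as a class of real-valued functions on labelled
examples: `(x, y)` is sent to the probability that `h x` gives to the label `y`. -/
def scoreClass {X Y : Type*} [Fintype Y] (H : Set (Hypothesis X Y)) : Set (X × Y → ℝ) :=
  (fun h : Hypothesis X Y => fun z : X × Y => (h z.1 : Y → ℝ) z.2) '' H

/-- The loss takes its values in `[0, 1]`. -/
def LossBounded {Y : Type*} [Fintype Y] (loss : stdSimplex ℝ Y → Y → ℝ) : Prop :=
  ∀ u y, 0 ≤ loss u y ∧ loss u y ≤ 1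

/-- The loss is `L`-Lipschitz in the score of the label, i.e. in the predicted probability
`u y` of the observed label `y`. (With two classes, `|u y - v y|` is the sup-distance of `u`
and `v`, so this is the Lipschitz condition on the whole prediction.) -/
def LossLipschitz {Y : Type*} [Fintype Y] (L : ℝ) (loss : stdSimplex ℝ Y → Y → ℝ) : Prop :=
  ∀ (u v : stdSimplex ℝ Y) (y : Y),
    |loss u y - loss v y| ≤ L * |(u : Y → ℝ) y - (v : Y → ℝ) y|

/-- The usual measurability condition on a hypothesis class: its members are measurable, and
they are pointwise limits of sequences taken from one countable subclass. -/
def PointwiseMeasurable {X Y : Type*} [MeasurableSpace X] [Fintype Y]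
    (H : Set (Hypothesis X Y)) : Prop :=
  (∀ h ∈ H, Measurable h) ∧
    ∃ H₀ ⊆ H, H₀.Countable ∧ ∀ h ∈ H, ∃ u : ℕ → Hypothesis X Y,
      (∀ n, u n ∈ H₀) ∧ ∀ x, Tendsto (fun n => u n x) atTop (𝓝 (h x))

/-- Expected loss of `h` under the distribution `D` of labelled examples. -/
def risk {X Y : Type*} [Fintype Y] [MeasurableSpace X] [MeasurableSpace Y]
    (loss : stdSimplex ℝ Y → Y → ℝ) (D : Measure (X × Y)) (h : Hypothesis X Y) : ℝ :=
  ∫ z, loss (h z.1) z.2 ∂D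

/-- Expected loss of `h` under the empirical distribution of the sample `s`. -/
def empiricalRisk {X Y : Type*} [Fintype Y] (loss : stdSimplex ℝ Y → Y → ℝ) {n : ℕ}
    (s : Fin n → X × Y) (h : Hypothesis X Y) : ℝ :=
  (∑ i, loss (h (s i).1) (s i).2) / n

/-- The pointwise mixture `(1 - a) * hc + a * hl`. -/
def interpolate {X Y : Type*} [Fintype Y] (a : unitInterval) (hc hl : Hypothesis X Y) :
    Hypothesis X Y := fun x =>
  ⟨(1 - (a : ℝ)) • (hc x : Y → ℝ) + (a : ℝ) • (hl x : Y → ℝ),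
    convex_stdSimplex ℝ Y (hc x).2 (hl x).2 (sub_nonneg.2 a.2.2) a.2.1 (by ring)⟩

/-- A family of interpolated models for `p` clients: one central hypothesis, and for each
client a weight in `[0, 1]` and a local hypothesis. -/
structure Model (p : ℕ) (X Y : Type*) [Fintype Y] where
  central : Hypothesis X Y
  weight : Fin p → unitInterval
  localHyp : Fin p → Hypothesis X Y

/-- The classifier used by client `k`. -/
def Model.predictor {p : ℕ} {X Y : Type*} [Fintype Y] (θ : Model p X Y) (k : Fin p) :
    Hypothesis X Y :=
  interpolate (θ.weight k) θ.central (θ.localHyp k)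

/-- The models with central hypothesis in `Hc` and local hypotheses in `Hl`. -/
def modelClass (p : ℕ) {X Y : Type*} [Fintype Y] (Hc Hl : Set (Hypothesis X Y)) :
    Set (Model p X Y) :=
  {θ | θ.central ∈ Hc ∧ ∀ k, θ.localHyp k ∈ Hl}

/-- The weighted true risk `∑ k, (m k / m) * L_{D k}((1 - λ k) h_c + λ k h_{l,k})`. -/
def totalRisk {p : ℕ} {X Y : Type*} [Fintype Y] [MeasurableSpace X] [MeasurableSpace Y]
    (loss : stdSimplex ℝ Y → Y → ℝ) (m : Fin p → ℕ) (D : Fin p → Measure (X × Y))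
    (θ : Model p X Y) : ℝ :=
  ∑ k, ((m k : ℝ) / ((∑ j, m j : ℕ) : ℝ)) * risk loss (D k) (θ.predictor k)

/-- The weighted empirical risk. -/
def totalEmpiricalRisk {p : ℕ} {X Y : Type*} [Fintype Y]
    (loss : stdSimplex ℝ Y → Y → ℝ) (m : Fin p → ℕ) (S : ∀ k, Fin (m k) → X × Y)
    (θ : Model p X Y) : ℝ :=
  ∑ k, ((m k : ℝ) / ((∑ j, m j : ℕ) : ℝ)) * empiricalRisk loss (S k) (θ.predictor k)

/-- `θ` minimizes `R` over the class `C`. -/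
def IsOptimal {A : Type*} (C : Set A) (R : A → ℝ) (θ : A) : Prop :=
  θ ∈ C ∧ IsMinOn R C θ

/-- The law of the samples: all examples are independent, and those of client `k` have
law `D k`. -/
def sampleLaw {p : ℕ} {X Y : Type*} [MeasurableSpace X] [MeasurableSpace Y]
    (m : Fin p → ℕ) (D : Fin p → Measure (X × Y)) :
    Measure (∀ k, Fin (m k) → X × Y) :=
  Measure.pi fun k => Measure.pi fun _ : Fin (m k) => D k

/-- The bound, with `m` the total number of examples. -/
def excessBound (L : ℝ) (p m dc dl : ℕ) (δ : ℝ) : ℝ :=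
  2 * L * (√((dc : ℝ) / m * Real.log (Real.exp 1 * m / dc))
      + √((dl : ℝ) * p / m * Real.log (Real.exp 1 * m / dl)))
    + 2 * √(Real.log (1 / δ) / m)

end ModelInterpolation

end

/-!
An empirical minimizer `θhat` has empirical risk at most that of the optimal model, so an excess
risk above the bound forces the deviation `F θhat - F̂ θhat`, corrected by the deviation
`F̂ θopt - F θopt` of one fixed model, to be large. It is enough to control the supremum of these
corrected deviations over all models, and by dominated convergence a countable family of models
suffices (`exists_countable_models`).

*Concentration.* One example changes the supremum, multiplied by the number `m` of examples, by at
most `2`. McDiarmid's inequality (`measure_ge_le_of_boundedDifferences`) then bounds the fluctuation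
around the mean; it follows from Hoeffding's lemma by integrating out one coordinate at a time.

*Expectation.* The correction has mean zero, and symmetrization with a ghost sample
(`integral_iSup_sub_le_of_rademacher_le`) bounds the mean of the supremum by twice a Rademacher
average, which is then estimated on every fixed sample (`rademacher_interpolate_le`).
* The contraction principle (`rademacher_le_of_abs_sub_le`) replaces the loss by `L` times the
  score of the label.
* The signed sum of an interpolated model is affine in each weight, so all weights may be taken in
  `{0, 1}` (`rademacher_interpolate_le_vertices`).
* Writing a score as the integral of its threshold indicators (`rademacher_le_of_threshold`)
  reduces to vectors with entries `±1/2`. By the Sauer–Shelah lemma the central class has at most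
  `(e m / dc) ^ dc` patterns at each threshold, and the local class at most `(e m / dl) ^ dl`. A
  vertex model is coded by a central pattern and, for each client, an optional local pattern; the
  option at most doubles the logarithm of the number of local patterns.
* Massart's lemma (`rademacher_le_sqrt`) for vectors of squared norm `m / 4` gives
  `√((a + 2 b) / 2)` per example, where `a` and `b` are the two terms under the square roots of the
  bound, and this is at most `√a + √b`.
-/

noncomputable section

namespace ModelInterpolation

open scoped BigOperators

/-! ### Rademacher averages of finite families of vectors -/

/-- The sign `±1` encoded by a Boolean. -/
def sgn (b : Bool) : ℝ := if b then 1 else -1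

@[simp] lemma sgn_not (b : Bool) : sgn (!b) = -sgn b := by cases b <;> simp [sgn]

lemma sgn_eq_or (b : Bool) : sgn b = 1 ∨ sgn b = -1 := by cases b <;> simp [sgn]

section Rademacher

variable {ι J : Type*} [Fintype ι] [DecidableEq ι]

/-- The (unnormalised) Rademacher average of a family of vectors: the mean, over uniformly
distributed signs, of the supremum of the signed sums. -/
def rademacher (v : J → ι → ℝ) : ℝ :=
  𝔼 σ : ι → Bool, ⨆ j, ∑ i, sgn (σ i) * v j i

/-- Flipping the sign at one coordinate. -/
def flipAt {ι : Type*} [DecidableEq ι] (i : ι) : (ι → Bool) ≃ (ι → Bool) :=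
  Function.Involutive.toPerm (fun σ => Function.update σ i (!σ i)) fun σ => by simp

lemma flipAt_apply {ι : Type*} [DecidableEq ι] (i : ι) (σ : ι → Bool) :
    flipAt i σ = Function.update σ i (!σ i) := rfl

lemma expect_flipAt (i : ι) (G : (ι → Bool) → ℝ) :
    𝔼 σ, G (flipAt i σ) = 𝔼 σ, G σ :=
  Fintype.expect_equiv (flipAt i) _ _ fun _ => rfl

/-- Choose maximizers `j` and `k` on the left: their increment `c j - c k` is at most
`|b j - b k|`, which is realised on the right by `(j, k)` or by `(k, j)`. -/
lemma iSup_add_iSup_le_of_abs_sub_le [Finite J] [Nonempty J] (a b c : J → ℝ)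
    (h : ∀ j j', |c j - c j'| ≤ |b j - b j'|) :
    (⨆ j, (a j + c j)) + (⨆ j, (a j - c j)) ≤ (⨆ j, (a j + b j)) + ⨆ j, (a j - b j) := by
  obtain ⟨j, hj⟩ := exists_eq_ciSup_of_finite (f := fun j => a j + c j)
  obtain ⟨k, hk⟩ := exists_eq_ciSup_of_finite (f := fun j => a j - c j)
  have hp (l : J) : a l + b l ≤ ⨆ j, (a j + b j) :=
    le_ciSup (f := fun j => a j + b j) (Set.finite_range _).bddAbove l
  have hm (l : J) : a l - b l ≤ ⨆ j, (a j - b j) :=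
    le_ciSup (f := fun j => a j - b j) (Set.finite_range _).bddAbove l
  rw [← hj, ← hk]
  have h1 := (le_abs_self _).trans (h j k)
  rcases abs_cases (b j - b k) with ⟨h2, -⟩ | ⟨h2, -⟩
  · linarith [hp j, hm k]
  · linarith [hp k, hm j]

lemma sum_sgn_update (w : ι → ℝ) (i : ι) (x : ℝ) (σ : ι → Bool) :
    ∑ k, sgn (σ k) * Function.update w i x k
      = (∑ k ∈ Finset.univ.erase i, sgn (σ k) * w k) + sgn (σ i) * x := by
  rw [← Finset.sum_erase_add _ _ (Finset.mem_univ i), Function.update_self]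
  congr 1
  refine Finset.sum_congr rfl fun k hk => ?_
  rw [Function.update_of_ne (Finset.ne_of_mem_erase hk)]

lemma sum_erase_flipAt (w : ι → ℝ) (i : ι) (σ : ι → Bool) :
    ∑ k ∈ Finset.univ.erase i, sgn (flipAt i σ k) * w k
      = ∑ k ∈ Finset.univ.erase i, sgn (σ k) * w k := by
  refine Finset.sum_congr rfl fun k hk => ?_
  rw [flipAt_apply, Function.update_of_ne (Finset.ne_of_mem_erase hk)]

/-- The contraction principle for a single coordinate: the signs `1` and `-1` at this coordinate
are averaged first, the others being fixed. -/
lemma rademacher_le_update [Finite J] [Nonempty J] (w : J → ι → ℝ) (i : ι) (b : J → ℝ)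
    (h : ∀ j j', |w j i - w j' i| ≤ |b j - b j'|) :
    rademacher w ≤ rademacher fun j => Function.update (w j) i (b j) := by
  have key (v : J → ι → ℝ) : rademacher v = 𝔼 σ : ι → Bool,
      ((⨆ j, ∑ k, sgn (σ k) * v j k) + ⨆ j, ∑ k, sgn (flipAt i σ k) * v j k) / 2 := by
    rw [← Finset.expect_div, Finset.expect_add_distrib,
      expect_flipAt i fun σ => ⨆ j, ∑ k, sgn (σ k) * v j k, add_self_div_two]
    rfl
  rw [key, key]
  refine Finset.expect_le_expect fun σ _ => ?_
  refine div_le_div_of_nonneg_right ?_ zero_le_two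
  have hw (τ : ι → Bool) (j : J) : ∑ k, sgn (τ k) * w j k
      = (∑ k ∈ Finset.univ.erase i, sgn (τ k) * w j k) + sgn (τ i) * w j i := by
    rw [Finset.sum_erase_add _ _ (Finset.mem_univ i)]
  simp only [hw, sum_sgn_update, sum_erase_flipAt]
  simp only [flipAt_apply, Function.update_self, sgn_not, neg_mul, ← sub_eq_add_neg]
  refine iSup_add_iSup_le_of_abs_sub_le _ _ _ fun j j' => ?_
  rw [← mul_sub, ← mul_sub, abs_mul, abs_mul]
  exact mul_le_mul_of_nonneg_left (h j j') (abs_nonneg _)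

/-- The contraction principle: a Rademacher average does not decrease when all the coordinatewise
distances within the family increase. -/
lemma rademacher_le_of_abs_sub_le [Finite J] [Nonempty J] (u v : J → ι → ℝ)
    (h : ∀ i j j', |u j i - u j' i| ≤ |v j i - v j' i|) : rademacher u ≤ rademacher v := by
  have key (s : Finset ι) :
      rademacher u ≤ rademacher fun j i => if i ∈ s then v j i else u j i := by
    induction s using Finset.induction_on with
    | empty => simp
    | insert i s hi ih =>
      refine ih.trans ?_
      refine (rademacher_le_update _ i (fun j => v j i) fun j j' => ?_).trans_eq ?_
      · simpa [hi] using h i j j'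
      · congr 1
        ext j k
        by_cases hk : k = i
        · subst hk; simp
        · simp [hk]
  simpa using key Finset.univ

lemma expect_exp_sum_sgn (v : ι → ℝ) :
    𝔼 σ : ι → Bool, Real.exp (∑ i, sgn (σ i) * v i) = ∏ i, Real.cosh (v i) := by
  have h (i : ι) : Real.cosh (v i) = (∑ b : Bool, Real.exp (sgn b * v i)) / 2 := by
    simp [Real.cosh_eq, sgn]
  simp_rw [h, Finset.prod_div_distrib, Finset.prod_univ_sum, Fintype.piFinset_univ, ← Real.exp_sum]
  rw [Fintype.expect_eq_sum_div_card]
  simp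

lemma exp_expect_le {α : Type*} [Fintype α] [Nonempty α] (g : α → ℝ) :
    Real.exp (𝔼 a, g a) ≤ 𝔼 a, Real.exp (g a) := by
  set c := 𝔼 a, g a with hc
  have h : 𝔼 a, Real.exp c * (1 + (g a - c)) ≤ 𝔼 a, Real.exp (g a) := by
    refine Finset.expect_le_expect fun a _ => ?_
    have := Real.add_one_le_exp (g a - c)
    calc Real.exp c * (1 + (g a - c)) ≤ Real.exp c * Real.exp (g a - c) :=
          mul_le_mul_of_nonneg_left (by linarith) (Real.exp_pos c).le
      _ = Real.exp (g a) := by rw [← Real.exp_add]; ring_nf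
  rw [← Finset.mul_expect, Finset.expect_add_distrib, Finset.expect_sub_distrib,
    Fintype.expect_const, Fintype.expect_const, ← hc] at h
  simpa using h

/-- Massart's finite class lemma. -/
lemma rademacher_le_sqrt [Finite J] [Nonempty J] (v : J → ι → ℝ) (V : Finset (ι → ℝ))
    (hV : ∀ j, v j ∈ V) {r K : ℝ} (hr : 0 < r) (hK : 0 < K)
    (hnorm : ∀ w ∈ V, ∑ i, w i ^ 2 ≤ r) (hcard : Real.log V.card ≤ K) :
    rademacher v ≤ √(2 * K * r) := by
  have hVpos : (0 : ℝ) < V.card := by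
    exact_mod_cast Finset.card_pos.2 ⟨_, hV (Classical.arbitrary J)⟩
  have key (s : ℝ) (hs : 0 < s) : s * rademacher v ≤ K + s ^ 2 * r / 2 := by
    rw [← Real.exp_le_exp, rademacher, Finset.mul_expect]
    refine (exp_expect_le _).trans ?_
    calc 𝔼 σ : ι → Bool, Real.exp (s * ⨆ j, ∑ i, sgn (σ i) * v j i)
        ≤ 𝔼 σ : ι → Bool, ∑ w ∈ V, Real.exp (∑ i, sgn (σ i) * (s * w i)) := by
          refine Finset.expect_le_expect fun σ _ => ?_
          obtain ⟨j, hj⟩ := exists_eq_ciSup_of_finite (f := fun j => ∑ i, sgn (σ i) * v j i)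
          rw [← hj, Finset.mul_sum]
          simp_rw [mul_left_comm s]
          exact Finset.single_le_sum
            (f := fun w : ι → ℝ => Real.exp (∑ i, sgn (σ i) * (s * w i)))
            (fun _ _ => (Real.exp_pos _).le) (hV j)
      _ = ∑ w ∈ V, ∏ i, Real.cosh (s * w i) := by
          rw [Finset.expect_sum_comm]
          exact Finset.sum_congr rfl fun w _ => expect_exp_sum_sgn _
      _ ≤ ∑ w ∈ V, Real.exp (s ^ 2 * r / 2) := by
          refine Finset.sum_le_sum fun w hw => ?_
          calc ∏ i, Real.cosh (s * w i) ≤ ∏ i, Real.exp ((s * w i) ^ 2 / 2) :=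
                Finset.prod_le_prod (fun i _ => (Real.cosh_pos _).le)
                  fun i _ => Real.cosh_le_exp_half_sq _
            _ = Real.exp (s ^ 2 * (∑ i, w i ^ 2) / 2) := by
                rw [← Real.exp_sum, Finset.mul_sum, Finset.sum_div]
                simp_rw [mul_pow]
            _ ≤ _ := by
                have := hnorm w hw
                gcongr
      _ = Real.exp (Real.log V.card) * Real.exp (s ^ 2 * r / 2) := by
          rw [Finset.sum_const, nsmul_eq_mul, Real.exp_log hVpos]
      _ ≤ Real.exp (K + s ^ 2 * r / 2) := by
          rw [← Real.exp_add]
          gcongr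
  -- The optimal parameter is `s = √(2K/r)`, written so that `s * √(2Kr) = 2K`.
  set q := √(2 * K * r) with hq
  have hq2 : q ^ 2 = 2 * K * r := Real.sq_sqrt (by positivity)
  have hqpos : 0 < q := Real.sqrt_pos.2 (by positivity)
  have h := key (q / r) (by positivity)
  have h2 : K + (q / r) ^ 2 * r / 2 = q / r * q := by
    field_simp
    rw [hq2]; ring
  rw [h2] at h
  exact le_of_mul_le_mul_left h (by positivity)

/-- Layer-cake reduction to threshold functions: a `[0, 1]`-valued family is, up to a constant,
the average over `t ∈ [0, 1]` of its threshold patterns at level `t`. -/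
lemma rademacher_le_of_threshold [Finite J] [Nonempty J] (w : J → ι → ℝ)
    (hw : ∀ j i, w j i ∈ Set.Icc (0 : ℝ) 1) {M : ℝ}
    (hM : ∀ t : ℝ, rademacher (fun j i => if t < w j i then (1 / 2 : ℝ) else -1 / 2) ≤ M) :
    rademacher w ≤ M := by
  -- Subtracting `1 / 2` makes the indicators symmetric, which halves their norm.
  set χ : ℝ → J → ι → ℝ := fun t j i => if t < w j i then (1 / 2 : ℝ) else -1 / 2 with hχ
  let μ : Measure ℝ := volume.restrict (Set.Ioc 0 1)
  have : IsProbabilityMeasure μ := ⟨by simp [μ]⟩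
  have hmeas (j : J) (i : ι) : Measurable fun t => χ t j i :=
    Measurable.ite (measurableSet_lt measurable_id measurable_const) measurable_const
      measurable_const
  have habs (t : ℝ) (j : J) (i : ι) : |χ t j i| ≤ 1 / 2 := by
    simp only [hχ]; split_ifs <;> norm_num [abs_of_nonneg]
  have hint (j : J) (i : ι) : Integrable (fun t => χ t j i) μ :=
    Integrable.of_bound (hmeas j i).aestronglyMeasurable (1 / 2)
      (Eventually.of_forall fun t => habs t j i)
  have hval (j : J) (i : ι) : ∫ t, χ t j i ∂μ = w j i - 1 / 2 := by
    have h1 : (fun t => χ t j i) =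
        fun t => (Set.Iio (w j i)).indicator (fun _ => (1 : ℝ)) t - 1 / 2 := by
      funext t
      by_cases h : t < w j i <;> simp [hχ, h] <;> norm_num
    have h2 : (volume.restrict (Set.Ioc (0 : ℝ) 1)).real (Set.Iio (w j i)) = w j i := by
      rw [measureReal_restrict_apply measurableSet_Iio]
      have h3 : Set.Iio (w j i) ∩ Set.Ioc 0 1 = Set.Ioo 0 (w j i) :=
        Set.ext fun x => ⟨fun hx => ⟨hx.2.1, hx.1⟩,
          fun hx => ⟨hx.2, hx.1, hx.2.le.trans (hw j i).2⟩⟩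
      rw [h3, Real.volume_real_Ioo_of_le (hw j i).1, sub_zero]
    rw [h1, integral_sub ((integrable_const _).indicator measurableSet_Iio) (integrable_const _),
      integral_indicator_const _ measurableSet_Iio, integral_const]
    simp [μ, h2]
  have hsum (σ : ι → Bool) (j : J) : Integrable (fun t => ∑ i, sgn (σ i) * χ t j i) μ :=
    integrable_finsetSum _ fun i _ => (hint j i).const_mul _
  have hsup (σ : ι → Bool) : Integrable (fun t => ⨆ j, ∑ i, sgn (σ i) * χ t j i) μ := by
    refine Integrable.of_bound (C := ∑ _i : ι, (1 / 2 : ℝ)) (Measurable.aestronglyMeasurable ?_)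
      (Eventually.of_forall fun t => ?_)
    · exact Measurable.iSup fun j => Finset.measurable_fun_sum _ fun i _ => (hmeas j i).const_mul _
    · obtain ⟨j, hj⟩ := exists_eq_ciSup_of_finite (f := fun j => ∑ i, sgn (σ i) * χ t j i)
      rw [← hj, Real.norm_eq_abs]
      refine (Finset.abs_sum_le_sum_abs _ _).trans (Finset.sum_le_sum fun i _ => ?_)
      rw [abs_mul]
      rcases sgn_eq_or (σ i) with h | h <;> simpa [h] using habs t j i
  calc rademacher w ≤ rademacher fun j i => w j i - 1 / 2 :=
        rademacher_le_of_abs_sub_le _ _ fun i j j' => by simp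
    _ ≤ 𝔼 σ : ι → Bool, ∫ t, ⨆ j, ∑ i, sgn (σ i) * χ t j i ∂μ := by
        refine Finset.expect_le_expect fun σ _ => ciSup_le fun j => ?_
        simp_rw [← hval, ← integral_const_mul]
        rw [← integral_finsetSum _ fun i _ => (hint j i).const_mul _]
        exact integral_mono (hsum σ j) (hsup σ) fun t =>
          le_ciSup (f := fun j => ∑ i, sgn (σ i) * χ t j i) (Set.finite_range _).bddAbove j
    _ = ∫ t, rademacher (χ t) ∂μ := by
        simp only [rademacher, Fintype.expect_eq_sum_div_card]
        rw [integral_div, integral_finsetSum _ fun σ _ => hsup σ]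
    _ ≤ ∫ _, M ∂μ := by
        refine integral_mono ?_ (integrable_const _) fun t => hM t
        simp only [rademacher, Fintype.expect_eq_sum_div_card]
        exact (integrable_finsetSum _ fun σ _ => hsup σ).div_const _
    _ = M := by simp

end Rademacher

/-! ### Symmetrization -/

section Symmetrization

variable {ι J Z : Type*} [Fintype ι] [DecidableEq ι] [MeasurableSpace Z]

lemma rademacher_neg_le [Finite J] [Nonempty J] (v : J → ι → ℝ) :
    rademacher (fun j i => -v j i) ≤ rademacher v :=
  rademacher_le_of_abs_sub_le _ _ fun i j j' => by rw [neg_sub_neg, abs_sub_comm]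

lemma rademacher_sub_le [Finite J] [Nonempty J] (u v : J → ι → ℝ) :
    rademacher (fun j i => u j i - v j i) ≤ rademacher u + rademacher v := by
  refine le_trans ?_ (add_le_add_right (rademacher_neg_le v) _)
  rw [rademacher, rademacher, rademacher, ← Finset.expect_add_distrib]
  refine Finset.expect_le_expect fun σ _ => ciSup_le fun j => ?_
  have h (w : J → ι → ℝ) : ∑ i, sgn (σ i) * w j i ≤ ⨆ j, ∑ i, sgn (σ i) * w j i :=
    le_ciSup (f := fun j => ∑ i, sgn (σ i) * w j i) (Set.finite_range _).bddAbove j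
  refine le_trans (le_of_eq ?_) (add_le_add (h u) (h fun j i => -v j i))
  rw [← Finset.sum_add_distrib]
  exact Finset.sum_congr rfl fun i _ => by ring

lemma abs_iSup_le_of_abs_le [Finite J] [Nonempty J] {g : J → ℝ} {C : ℝ} (h : ∀ j, |g j| ≤ C) :
    |⨆ j, g j| ≤ C := by
  obtain ⟨j, hj⟩ := exists_eq_ciSup_of_finite (f := g)
  exact hj ▸ h j

lemma integrable_iSup_sum {ι J : Type*} [Fintype ι] [Finite J] [Nonempty J] {Ω : Type*}
    [MeasurableSpace Ω] (P : Measure Ω) [IsFiniteMeasure P] (g : J → ι → Ω → ℝ)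
    (hg : ∀ j i, Measurable (g j i)) {C : ℝ}
    (hC : ∀ j i ω, |g j i ω| ≤ C) : Integrable (fun ω => ⨆ j, ∑ i, g j i ω) P := by
  refine Integrable.of_bound (C := ∑ _i : ι, C) (Measurable.aestronglyMeasurable ?_)
    (Eventually.of_forall fun ω => ?_)
  · exact Measurable.iSup fun j => Finset.measurable_fun_sum _ fun i _ => hg j i
  · exact abs_iSup_le_of_abs_le fun j =>
      (Finset.abs_sum_le_sum_abs _ _).trans (Finset.sum_le_sum fun i _ => hC j i ω)

/-- Symmetrization: the expected one-sided uniform deviation of the empirical sums from their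
means is at most twice the Rademacher average. -/
lemma integral_iSup_sub_le_of_rademacher_le [Finite J] [Nonempty J] (ν : ι → Measure Z)
    [∀ i, IsProbabilityMeasure (ν i)] (f : J → ι → Z → ℝ) (hf : ∀ j i, Measurable (f j i))
    (hf01 : ∀ j i z, f j i z ∈ Set.Icc (0 : ℝ) 1) {R : ℝ}
    (hR : ∀ S : ι → Z, rademacher (fun j i => f j i (S i)) ≤ R) :
    ∫ S, (⨆ j, ∑ i, (∫ z, f j i z ∂ν i - f j i (S i))) ∂Measure.pi ν ≤ 2 * R := by
  set P := Measure.pi ν with hP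
  set Q := Measure.pi fun i => (ν i).prod (ν i) with hQ
  have hint (j : J) (i : ι) : Integrable (f j i) (ν i) :=
    Integrable.of_mem_Icc 0 1 (hf j i).aemeasurable (Eventually.of_forall (hf01 j i))
  have hmean (j : J) (i : ι) : ∫ z, f j i z ∂ν i ∈ Set.Icc (0 : ℝ) 1 :=
    ⟨integral_nonneg fun z => (hf01 j i z).1,
      (integral_mono (hint j i) (integrable_const 1) fun z => (hf01 j i z).2).trans (by simp)⟩
  have hdiff {x y : ℝ} (hx : x ∈ Set.Icc (0 : ℝ) 1) (hy : y ∈ Set.Icc (0 : ℝ) 1) :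
      |x - y| ≤ 1 := abs_le.2 ⟨by linarith [hx.1, hy.2], by linarith [hx.2, hy.1]⟩
  -- The ghost sample is the first component.
  set G : (ι → Z) × (ι → Z) → ℝ := fun w => ⨆ j, ∑ i, (f j i (w.1 i) - f j i (w.2 i)) with hG
  have hGint : Integrable G (P.prod P) :=
    integrable_iSup_sum _ (fun j i (w : (ι → Z) × (ι → Z)) => f j i (w.1 i) - f j i (w.2 i))
      (fun j i => ((hf j i).comp (by fun_prop)).sub ((hf j i).comp (by fun_prop)))
      (C := 1) fun j i w => hdiff (hf01 _ _ _) (hf01 _ _ _)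
  have hghost (S : ι → Z) (j : J) :
      ∑ i, (∫ z, f j i z ∂ν i - f j i (S i)) = ∫ S', ∑ i, (f j i (S' i) - f j i (S i)) ∂P := by
    have h1 (i : ι) : Integrable (fun S' : ι → Z => f j i (S' i)) P :=
      (measurePreserving_eval ν i).integrable_comp_of_integrable (hint j i)
    have h3 (i : ι) : Integrable (fun S' : ι → Z => f j i (S' i) - f j i (S i)) P :=
      (h1 i).sub (integrable_const _)
    rw [integral_finsetSum _ fun i _ => h3 i]
    refine Finset.sum_congr rfl fun i _ => ?_
    rw [integral_sub (h1 i) (integrable_const _)]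
    have h2 := integral_comp_eval (μ := ν) (i := i) (f := f j i)
      (hf j i).aestronglyMeasurable
    simp only [integral_const, probReal_univ, one_smul]
    rw [h2]
  have hsec (S : ι → Z) : Integrable (fun S' => G (S', S)) P :=
    integrable_iSup_sum _ (fun j i (S' : ι → Z) => f j i (S' i) - f j i (S i))
      (fun j i => ((hf j i).comp (by fun_prop)).sub measurable_const)
      (C := 1) fun j i w => hdiff (hf01 _ _ _) (hf01 _ _ _)
  have hjensen (S : ι → Z) :
      (⨆ j, ∑ i, (∫ z, f j i z ∂ν i - f j i (S i))) ≤ ∫ S', G (S', S) ∂P := by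
    refine ciSup_le fun j => ?_
    rw [hghost]
    refine integral_mono ?_ (hsec S) fun S' =>
      le_ciSup (f := fun j => ∑ i, (f j i (S' i) - f j i (S i))) (Set.finite_range _).bddAbove j
    exact integrable_finsetSum _ fun i _ =>
      ((measurePreserving_eval ν i).integrable_comp_of_integrable (hint j i)).sub
        (integrable_const _)
  -- The coordinatewise pairs are exchangeable, so a random sign may be inserted.
  set T : (ι → Bool) → (ι → Z × Z) → ℝ :=
    fun σ w => ⨆ j, ∑ i, sgn (σ i) * (f j i (w i).1 - f j i (w i).2) with hT
  have hTint (σ : ι → Bool) : Integrable (T σ) Q :=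
    integrable_iSup_sum _
      (fun j i (w : ι → Z × Z) => sgn (σ i) * (f j i (w i).1 - f j i (w i).2))
      (fun j i => (((hf j i).comp (by fun_prop)).sub ((hf j i).comp (by fun_prop))).const_mul _)
      (C := 1) fun j i w => by
        rcases sgn_eq_or (σ i) with h | h <;>
          simpa [h, abs_sub_comm] using hdiff (hf01 j i (w i).1) (hf01 j i (w i).2)
  have hpair : ∫ w, G w ∂P.prod P = ∫ w, T (fun _ => true) w ∂Q := by
    have h := (measurePreserving_arrowProdEquivProdArrow Z Z ι ν ν).integral_comp' G
    rw [← h]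
    simp [hG, hT, sgn, MeasurableEquiv.arrowProdEquivProdArrow, Equiv.arrowProdEquivProdArrow, hQ]
  have hswap (σ : ι → Bool) : ∫ w, T σ w ∂Q = ∫ w, T (fun _ => true) w ∂Q := by
    let e (i : ι) : Z × Z ≃ᵐ Z × Z :=
      if σ i then MeasurableEquiv.refl _ else MeasurableEquiv.prodComm
    have he (i : ι) : MeasurePreserving (e i) ((ν i).prod (ν i)) ((ν i).prod (ν i)) := by
      by_cases h : σ i
      · simp only [e, h, if_true]
        exact MeasurePreserving.id _
      · simp only [e, h]
        exact Measure.measurePreserving_swap (μ := ν i) (ν := ν i)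
    have hmp := measurePreserving_pi (fun i => (ν i).prod (ν i)) (fun i => (ν i).prod (ν i)) he
    have h := hmp.integral_comp' (f := MeasurableEquiv.piCongrRight e) (T fun _ => true)
    rw [← h]
    refine integral_congr_ae (Eventually.of_forall fun w => ?_)
    simp only [hT]
    congr 1
    ext j
    refine Finset.sum_congr rfl fun i _ => ?_
    have : (MeasurableEquiv.piCongrRight e) w i = e i (w i) := rfl
    rw [this]
    by_cases h : σ i <;> simp [e, h, sgn, MeasurableEquiv.prodComm]
  calc ∫ S, (⨆ j, ∑ i, (∫ z, f j i z ∂ν i - f j i (S i))) ∂P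
      ≤ ∫ S, ∫ S', G (S', S) ∂P ∂P := by
        refine integral_mono ?_ hGint.swap.integral_prod_left hjensen
        exact integrable_iSup_sum _ (fun j i (S : ι → Z) => ∫ z, f j i z ∂ν i - f j i (S i))
          (fun j i => measurable_const.sub ((hf j i).comp (by fun_prop)))
          (C := 1) fun j i w => hdiff (hmean _ _) (hf01 _ _ _)
    _ = ∫ w, T (fun _ => true) w ∂Q := by
        rw [← integral_prod_symm _ hGint, hpair]
    _ = ∫ w, (𝔼 σ, T σ w) ∂Q := by
        simp only [Fintype.expect_eq_sum_div_card]
        rw [integral_div, integral_finsetSum _ fun σ _ => hTint σ]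
        simp_rw [hswap]
        simp
    _ ≤ ∫ _, 2 * R ∂Q := by
        refine integral_mono ?_ (integrable_const _) fun w => ?_
        · simp only [Fintype.expect_eq_sum_div_card]
          exact (integrable_finsetSum _ fun σ _ => hTint σ).div_const _
        · have h := rademacher_sub_le (fun j i => f j i (w i).1) fun j i => f j i (w i).2
          have h1 := hR fun i => (w i).1
          have h2 := hR fun i => (w i).2
          calc (𝔼 σ, T σ w) = rademacher fun j i => f j i (w i).1 - f j i (w i).2 := rfl
            _ ≤ 2 * R := by linarith
    _ = 2 * R := by simp

end Symmetrization

/-! ### McDiarmid's inequality -/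

section BoundedDifferences

variable {Z : Type*} [MeasurableSpace Z]

lemma integral_pi_succ {n : ℕ} (ν : Fin (n + 1) → Measure Z) [∀ i, IsProbabilityMeasure (ν i)]
    (f : (Fin (n + 1) → Z) → ℝ) :
    ∫ S, f S ∂Measure.pi ν
      = ∫ w, f (Fin.cons w.1 w.2) ∂(ν 0).prod (Measure.pi fun i => ν i.succ) := by
  have h := ((measurePreserving_piFinSuccAbove ν 0).symm _).integral_comp' f
  rw [← h]
  simp [MeasurableEquiv.piFinSuccAbove, Fin.insertNthEquiv]

/-- A bounded-difference function has a sub-Gaussian moment generating function: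
Hoeffding's lemma applies to the conditional mean given the first coordinate, and the remaining
coordinates are treated by induction. -/
lemma integral_exp_sub_le_of_boundedDifferences {n : ℕ} (ν : Fin n → Measure Z)
    [∀ i, IsProbabilityMeasure (ν i)] (f : (Fin n → Z) → ℝ) (hf : Measurable f) {C : ℝ}
    (hC : ∀ S, |f S| ≤ C) (c : Fin n → ℝ)
    (hc : ∀ S i z, |f S - f (Function.update S i z)| ≤ c i) (s : ℝ) :
    ∫ S, Real.exp (s * (f S - ∫ S', f S' ∂Measure.pi ν)) ∂Measure.pi ν
      ≤ Real.exp (s ^ 2 * (∑ i, c i ^ 2) / 8) := by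
  induction n with
  | zero =>
    have h (S : Fin 0 → Z) : f S = f default := congrArg f (Subsingleton.elim _ _)
    simp [h]
  | succ n ih =>
    set P := Measure.pi fun i : Fin n => ν i.succ with hP
    set g : Z → ℝ := fun z => ∫ S, f (Fin.cons z S) ∂P with hg
    have hmf : Measurable fun w : Z × (Fin n → Z) => f (Fin.cons w.1 w.2) := by
      refine hf.comp (measurable_pi_lambda _ fun i => ?_)
      refine Fin.cases ?_ (fun i => ?_) i
      · simpa using measurable_fst
      · simpa [Function.comp_def] using (measurable_pi_apply (X := fun _ : Fin n => Z) i).comp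
          (measurable_snd (α := Z))
    have hmz (z : Z) : Measurable fun S : Fin n → Z => f (Fin.cons z S) :=
      hmf.comp measurable_prodMk_left
    have hintz (z : Z) : Integrable (fun S => f (Fin.cons z S)) P :=
      Integrable.of_bound (hmz z).aestronglyMeasurable C (Eventually.of_forall fun S => hC _)
    have hintf : Integrable (fun w : Z × (Fin n → Z) => f (Fin.cons w.1 w.2)) ((ν 0).prod P) :=
      Integrable.of_bound hmf.aestronglyMeasurable C (Eventually.of_forall fun S => hC _)
    have hgm : Measurable g := hmf.stronglyMeasurable.integral_prod_right'.measurable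
    have hgC (z : Z) : |g z| ≤ C := by
      have := norm_integral_le_of_norm_le_const (μ := P) (f := fun S => f (Fin.cons z S)) (C := C)
        (Eventually.of_forall fun S => hC _)
      simpa using this
    have hgdiff (z z' : Z) : g z - g z' ≤ c 0 := by
      rw [hg]
      simp only
      rw [← integral_sub (hintz z) (hintz z')]
      calc ∫ S, (f (Fin.cons z S) - f (Fin.cons z' S)) ∂P ≤ ∫ _, c 0 ∂P := by
            refine integral_mono ((hintz z).sub (hintz z')) (integrable_const _) fun S => ?_
            have := hc (Fin.cons z S) 0 z'
            rw [Fin.update_cons_zero] at this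
            exact (le_abs_self _).trans this
        _ = c 0 := by simp
    have hmean : ∫ S, f S ∂Measure.pi ν = ∫ z, g z ∂ν 0 := by
      rw [integral_pi_succ, integral_prod _ hintf]
    set E := ∫ z, g z ∂ν 0 with hE
    rw [hmean, integral_pi_succ]
    have : Nonempty Z := nonempty_of_isProbabilityMeasure (ν 0)
    -- The conditional mean `g` ranges over an interval of length `c 0`.
    have hbdd : BddBelow (Set.range g) := ⟨-C, by rintro _ ⟨z, rfl⟩; exact (abs_le.1 (hgC z)).1⟩
    have hrange (z : Z) : g z ∈ Set.Icc (⨅ z, g z) ((⨅ z, g z) + c 0) :=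
      ⟨ciInf_le hbdd z, by linarith [le_ciInf fun z' => sub_le_comm.1 (hgdiff z z')]⟩
    have hoeff := (ProbabilityTheory.hasSubgaussianMGF_of_mem_Icc (μ := ν 0) hgm.aemeasurable
      (Eventually.of_forall hrange)).mgf_le s
    have hexpint : Integrable (fun z => Real.exp (s * (g z - E))) (ν 0) :=
      (ProbabilityTheory.hasSubgaussianMGF_of_mem_Icc (μ := ν 0) hgm.aemeasurable
        (Eventually.of_forall hrange)).integrable_exp_mul s
    have hinner (z : Z) : ∫ S, Real.exp (s * (f (Fin.cons z S) - g z)) ∂P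
        ≤ Real.exp (s ^ 2 * (∑ i : Fin n, c i.succ ^ 2) / 8) := by
      refine ih (fun i => ν i.succ) (fun S => f (Fin.cons z S)) (hmz z) (fun S => hC _)
        (fun i => c i.succ) fun S i z' => ?_
      have := hc (Fin.cons z S) i.succ z'
      rwa [← Fin.cons_update] at this
    have hintexp : Integrable
        (fun w : Z × (Fin n → Z) => Real.exp (s * (f (Fin.cons w.1 w.2) - E))) ((ν 0).prod P) := by
      refine Integrable.of_bound (C := Real.exp (|s| * (C + |E|)))
        (Real.measurable_exp.comp ((hmf.sub_const E).const_mul s)).aestronglyMeasurable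
        (Eventually.of_forall fun w => ?_)
      rw [Real.norm_eq_abs, Real.abs_exp, Real.exp_le_exp]
      refine (le_abs_self _).trans ?_
      rw [abs_mul]
      refine mul_le_mul_of_nonneg_left ((abs_sub _ _).trans ?_) (abs_nonneg _)
      linarith [hC (Fin.cons w.1 w.2)]
    rw [integral_prod _ hintexp]
    calc ∫ z, ∫ S, Real.exp (s * (f (Fin.cons z S) - E)) ∂P ∂ν 0
        = ∫ z, Real.exp (s * (g z - E)) * ∫ S, Real.exp (s * (f (Fin.cons z S) - g z)) ∂P ∂ν 0 := by
          refine integral_congr_ae (Eventually.of_forall fun z => ?_)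
          simp only
          rw [← integral_const_mul]
          refine integral_congr_ae (Eventually.of_forall fun S => ?_)
          simp only
          rw [← Real.exp_add]
          ring_nf
      _ ≤ ∫ z, Real.exp (s * (g z - E)) *
            Real.exp (s ^ 2 * (∑ i : Fin n, c i.succ ^ 2) / 8) ∂ν 0 := by
          refine integral_mono_of_nonneg (Eventually.of_forall fun z => ?_)
            (hexpint.mul_const _) (Eventually.of_forall fun z => ?_)
          · exact mul_nonneg (Real.exp_pos _).le (integral_nonneg fun S => (Real.exp_pos _).le)
          · exact mul_le_mul_of_nonneg_left (hinner z) (Real.exp_pos _).le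
      _ ≤ Real.exp (c 0 ^ 2 * s ^ 2 / 8) *
            Real.exp (s ^ 2 * (∑ i : Fin n, c i.succ ^ 2) / 8) := by
          rw [integral_mul_const]
          refine mul_le_mul_of_nonneg_right (hoeff.trans_eq ?_) (Real.exp_pos _).le
          congr 1
          simp only [add_sub_cancel_left, NNReal.coe_pow, NNReal.coe_div, coe_nnnorm,
            Real.norm_eq_abs, NNReal.coe_ofNat, div_pow, sq_abs]
          ring
      _ = _ := by
          rw [← Real.exp_add, Fin.sum_univ_succ]
          congr 1
          ring

/-- McDiarmid's inequality, for a product of arbitrary laws on one space. -/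
lemma measure_ge_le_of_boundedDifferences {ι : Type*} [Fintype ι] [DecidableEq ι]
    (ν : ι → Measure Z) [∀ i, IsProbabilityMeasure (ν i)] (f : (ι → Z) → ℝ) (hf : Measurable f)
    {C : ℝ} (hC : ∀ S, |f S| ≤ C) (c : ι → ℝ)
    (hc : ∀ S i z, |f S - f (Function.update S i z)| ≤ c i) (hpos : 0 < ∑ i, c i ^ 2)
    {t : ℝ} (ht : 0 ≤ t) :
    (Measure.pi ν).real {S | ∫ S', f S' ∂Measure.pi ν + t ≤ f S}
      ≤ Real.exp (-(2 * t ^ 2 / ∑ i, c i ^ 2)) := by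
  have hmgf (s : ℝ) : ∫ S, Real.exp (s * (f S - ∫ S', f S' ∂Measure.pi ν)) ∂Measure.pi ν
      ≤ Real.exp (s ^ 2 * (∑ i, c i ^ 2) / 8) := by
    let e := (Fintype.equivFin ι).symm
    let T := MeasurableEquiv.piCongrLeft (fun _ : ι => Z) e
    have hT : MeasurePreserving T (Measure.pi fun i => ν (e i)) (Measure.pi ν) :=
      measurePreserving_piCongrLeft (α := fun _ : ι => Z) ν e
    have hTapp (S : Fin (Fintype.card ι) → Z) : T S = S ∘ e.symm := by
      ext i
      have := MeasurableEquiv.piCongrLeft_apply_apply (β := fun _ : ι => Z) e S (e.symm i)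
      simpa using this
    have h := integral_exp_sub_le_of_boundedDifferences (fun i => ν (e i)) (fun S => f (T S))
      (hf.comp T.measurable) (fun S => hC _) (fun i => c (e i)) (fun S i z => by
        have h1 : T (Function.update S i z) = Function.update (T S) (e i) z := by
          rw [hTapp, hTapp, Function.update_comp_equiv, Equiv.symm_symm]
        rw [h1]
        exact hc _ _ _) s
    rw [hT.integral_comp' f, Equiv.sum_comp e fun i => c i ^ 2] at h
    rwa [hT.integral_comp' fun S => Real.exp (s * (f S - ∫ S', f S' ∂Measure.pi ν))] at h
  set E := ∫ S', f S' ∂Measure.pi ν with hE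
  set V := ∑ i, c i ^ 2 with hV
  -- The Chernoff bound at the minimizer `4 t / V` of `s ^ 2 * V / 8 - s * t`.
  have hs : 0 ≤ 4 * t / V := by positivity
  have hch := ProbabilityTheory.measure_ge_le_exp_mul_mgf (μ := Measure.pi ν)
    (X := fun S => f S - E) t hs ?_
  · have hset : {S | E + t ≤ f S} = {S | t ≤ f S - E} := by
      ext S; change E + t ≤ f S ↔ t ≤ f S - E; constructor <;> intro h <;> linarith
    rw [hset]
    refine hch.trans ?_
    calc Real.exp (-(4 * t / V) * t) *
          ProbabilityTheory.mgf (fun S => f S - E) (Measure.pi ν) (4 * t / V)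
        ≤ Real.exp (-(4 * t / V) * t) * Real.exp ((4 * t / V) ^ 2 * V / 8) :=
          mul_le_mul_of_nonneg_left (hmgf _) (Real.exp_pos _).le
      _ = Real.exp (-(2 * t ^ 2 / V)) := by
          rw [← Real.exp_add]
          congr 1
          field_simp
          ring
  · refine ProbabilityTheory.integrable_exp_mul_of_mem_Icc (a := -C - E) (b := C - E)
      (hf.sub_const E).aemeasurable (Eventually.of_forall fun S => ?_)
    have := abs_le.1 (hC S)
    exact ⟨by linarith [this.1], by linarith [this.2]⟩

end BoundedDifferences

/-! ### Threshold patterns and the Sauer–Shelah lemma -/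

lemma sum_choose_le {d m : ℕ} (hd : 1 ≤ d) (hdm : d ≤ m) :
    ∑ k ∈ Finset.Iic d, (m.choose k : ℝ) ≤ (Real.exp 1 * m / d) ^ d := by
  have hd0 : (0 : ℝ) < d := by exact_mod_cast hd
  have hm0 : (0 : ℝ) < m := by exact_mod_cast hd.trans hdm
  have hq : (d : ℝ) / m ≤ 1 := (div_le_one hm0).2 (by exact_mod_cast hdm)
  have h1 : (∑ k ∈ Finset.Iic d, (m.choose k : ℝ)) * ((d : ℝ) / m) ^ d ≤ Real.exp d := by
    calc (∑ k ∈ Finset.Iic d, (m.choose k : ℝ)) * ((d : ℝ) / m) ^ d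
        ≤ ∑ k ∈ Finset.Iic d, ((d : ℝ) / m) ^ k * m.choose k := by
          rw [Finset.sum_mul]
          refine Finset.sum_le_sum fun k hk => ?_
          rw [mul_comm]
          exact mul_le_mul_of_nonneg_right
            (pow_le_pow_of_le_one (by positivity) hq (Finset.mem_Iic.1 hk)) (Nat.cast_nonneg _)
      _ ≤ ∑ k ∈ Finset.range (m + 1), ((d : ℝ) / m) ^ k * m.choose k := by
          refine Finset.sum_le_sum_of_subset_of_nonneg (fun k hk => ?_) fun k _ _ => by positivity
          have := Finset.mem_Iic.1 hk
          exact Finset.mem_range.2 (by omega)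
      _ = ((d : ℝ) / m + 1) ^ m := by
          rw [add_pow]
          simp
      _ ≤ Real.exp (d / m) ^ m := by
          gcongr
          exact Real.add_one_le_exp _
      _ = Real.exp d := by
          rw [← Real.exp_nat_mul]
          congr 1
          field_simp
  have h2 : (Real.exp 1 * m / d) ^ d * ((d : ℝ) / m) ^ d = Real.exp d := by
    rw [← mul_pow]
    have : Real.exp 1 * m / d * ((d : ℝ) / m) = Real.exp 1 := by field_simp
    rw [this, ← Real.exp_nat_mul, mul_one]
  rw [← h2] at h1
  exact le_of_mul_le_mul_right h1 (by positivity)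

lemma mul_log_nonneg {d m : ℕ} (hdm : d ≤ m) :
    0 ≤ (d : ℝ) * Real.log (Real.exp 1 * m / d) := by
  rcases Nat.eq_zero_or_pos d with rfl | hd
  · simp
  have hd0 : (0 : ℝ) < d := by exact_mod_cast hd
  refine mul_nonneg hd0.le (Real.log_nonneg ((one_le_div hd0).2 ?_))
  calc (d : ℝ) ≤ 1 * m := by rw [one_mul]; exact_mod_cast hdm
    _ ≤ Real.exp 1 * m := by gcongr; exact Real.one_le_exp zero_le_one

lemma one_le_mul_log {d m : ℕ} (hd : 1 ≤ d) (hdm : d ≤ m) :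
    1 ≤ (d : ℝ) * Real.log (Real.exp 1 * m / d) := by
  have hd0 : (0 : ℝ) < d := by exact_mod_cast hd
  have h : 1 ≤ Real.log (Real.exp 1 * m / d) := by
    rw [Real.le_log_iff_exp_le (by have := hd.trans hdm; positivity), mul_div_assoc]
    refine le_mul_of_one_le_right (Real.exp_pos 1).le ((one_le_div hd0).2 ?_)
    exact_mod_cast hdm
  calc (1 : ℝ) ≤ d := by exact_mod_cast hd
    _ ≤ _ := le_mul_of_one_le_right hd0.le h

section Patterns

variable {ι : Type*} [Fintype ι] [DecidableEq ι]

/-- The Sauer–Shelah lemma in logarithmic form. -/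
lemma log_card_le_of_vcDim_le (A : Finset (Finset ι)) {d : ℕ} (hd : A.vcDim ≤ d)
    (hdm : d ≤ Fintype.card ι) :
    Real.log A.card ≤ d * Real.log (Real.exp 1 * (Fintype.card ι : ℕ) / d) := by
  rcases A.eq_empty_or_nonempty with rfl | hne
  · simpa using mul_log_nonneg hdm
  have hA : (0 : ℝ) < A.card := by exact_mod_cast Finset.card_pos.2 hne
  have h1 : (A.card : ℝ) ≤ ∑ k ∈ Finset.Iic d, ((Fintype.card ι).choose k : ℝ) := by
    have h2 := A.card_le_card_shatterer.trans (Finset.card_shatterer_le_sum_vcDim (𝒜 := A))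
    have h3 : ∑ k ∈ Finset.Iic A.vcDim, (Fintype.card ι).choose k
        ≤ ∑ k ∈ Finset.Iic d, (Fintype.card ι).choose k :=
      Finset.sum_le_sum_of_subset (Finset.Iic_subset_Iic.2 hd)
    exact_mod_cast h2.trans h3
  rcases Nat.eq_zero_or_pos d with rfl | hd1
  · have h4 : (A.card : ℝ) ≤ 1 := by
      have h5 : Finset.Iic 0 = ({0} : Finset ℕ) := rfl
      simpa [h5] using h1
    simpa using Real.log_nonpos hA.le h4
  · rw [← Real.log_pow]
    exact Real.log_le_log hA (h1.trans (sum_choose_le hd1 hdm))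

open Classical in
/-- The subsets of the index set of a sample `S` that are cut out by the functions of the class
`F` at level `t`. -/
def thresholdPatterns {Z : Type*} (F : Set (Z → ℝ)) (S : ι → Z) (t : ℝ) : Finset (Finset ι) :=
  Finset.univ.filter fun T => ∃ f ∈ F, ∀ i, i ∈ T ↔ t < f (S i)

/-- Sample points may coincide, but those with indices in a shattered set are distinct, and form
a pseudo-shattered set with constant threshold. -/
lemma vcDim_thresholdPatterns_le {Z : Type*} (F : Set (Z → ℝ)) (S : ι → Z) (t : ℝ) {d : ℕ}
    (hd : pseudoDim F = d) : (thresholdPatterns F S t).vcDim ≤ d := by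
  classical
  refine Finset.sup_le fun s hs => ?_
  rw [Finset.mem_shatterer] at hs
  have hpat {T : Finset ι} (hT : T ⊆ s) : ∃ f ∈ F, ∀ i ∈ s, i ∈ T ↔ t < f (S i) := by
    obtain ⟨u, hu, rfl⟩ := hs hT
    obtain ⟨f, hf, hfu⟩ := (Finset.mem_filter.1 hu).2
    exact ⟨f, hf, fun i hi => by simp [hi, hfu]⟩
  have hinj : Set.InjOn S s := by
    intro i hi j hj hij
    obtain ⟨f, -, hf⟩ := hpat (Finset.singleton_subset_iff.2 hi)
    have h1 := (hf i hi).1 (Finset.mem_singleton_self i)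
    rw [hij] at h1
    exact (Finset.mem_singleton.1 ((hf j hj).2 h1)).symm
  have hsh : PseudoShatters F (s.image S) := by
    refine ⟨fun _ => t, fun T _ => ?_⟩
    obtain ⟨f, hf, h⟩ := hpat (Finset.filter_subset (fun i => S i ∈ T) s)
    refine ⟨f, hf, fun z hz => ?_⟩
    obtain ⟨i, hi, rfl⟩ := Finset.mem_image.1 hz
    rw [← h i hi]
    simp [hi]
  have hle : ((s.image S).card : ℕ∞) ≤ pseudoDim F :=
    le_iSup₂ (f := fun (T : Finset Z) (_ : T ∈ {T : Finset Z | PseudoShatters F T}) =>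
      (T.card : ℕ∞)) (s.image S) hsh
  rw [hd, Finset.card_image_of_injOn hinj] at hle
  exact_mod_cast hle

lemma log_card_thresholdPatterns_le {Z : Type*} (F : Set (Z → ℝ)) (S : ι → Z) (t : ℝ) {d : ℕ}
    (hd : pseudoDim F = d) (hdm : d ≤ Fintype.card ι) :
    Real.log (thresholdPatterns F S t).card
      ≤ d * Real.log (Real.exp 1 * (Fintype.card ι : ℕ) / d) :=
  log_card_le_of_vcDim_le _ (vcDim_thresholdPatterns_le F S t hd) hdm

lemma log_succ_le_two_mul {n : ℕ} {B : ℝ} (hB : 1 ≤ B) (hn : Real.log n ≤ B) :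
    Real.log (n + 1 : ℕ) ≤ 2 * B := by
  have h1 : (n : ℝ) ≤ Real.exp B := by
    rcases Nat.eq_zero_or_pos n with rfl | hpos
    · simpa using (Real.exp_pos B).le
    · exact (Real.log_le_iff_le_exp (by exact_mod_cast hpos)).1 hn
  have h2 : 2 ≤ Real.exp B := by linarith [Real.add_one_le_exp B]
  rw [Real.log_le_iff_le_exp (by positivity), two_mul, Real.exp_add]
  push_cast
  nlinarith

end Patterns

/-! ### Rademacher averages of interpolated scores -/

section Interpolation

variable {ι K J Z : Type*} [Fintype ι] [DecidableEq ι] [Fintype K] [DecidableEq K]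

/-- For fixed signs, the signed sum of an interpolated model is affine in each interpolation
weight, hence dominated by a model that picks, for each client, the central or the local
hypothesis. -/
lemma rademacher_interpolate_le_vertices [Finite J] [Nonempty J] (κ : ι → K)
    (a : J → K → unitInterval) (u v : J → ι → ℝ) :
    rademacher (fun j i => (1 - (a j (κ i) : ℝ)) * u j i + (a j (κ i) : ℝ) * v j i)
      ≤ rademacher fun (q : J × (K → Bool)) i => if q.2 (κ i) then v q.1 i else u q.1 i := by
  refine Finset.expect_le_expect fun σ _ => ciSup_le fun j => ?_
  let A (k : K) : ℝ := ∑ i with κ i = k, sgn (σ i) * u j i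
  let B (k : K) : ℝ := ∑ i with κ i = k, sgn (σ i) * v j i
  let Λ (k : K) : Bool := decide (A k ≤ B k)
  refine le_trans ?_ (le_ciSup (f := fun q : J × (K → Bool) =>
    ∑ i, sgn (σ i) * if q.2 (κ i) then v q.1 i else u q.1 i) (Set.finite_range _).bddAbove (j, Λ))
  rw [← Finset.sum_fiberwise Finset.univ κ, ← Finset.sum_fiberwise Finset.univ κ]
  refine Finset.sum_le_sum fun k _ => ?_
  have h1 : ∑ i with κ i = k,
      sgn (σ i) * ((1 - (a j (κ i) : ℝ)) * u j i + (a j (κ i) : ℝ) * v j i)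
      = (1 - (a j k : ℝ)) * A k + (a j k : ℝ) * B k := by
    rw [Finset.mul_sum, Finset.mul_sum, ← Finset.sum_add_distrib]
    refine Finset.sum_congr rfl fun i hi => ?_
    rw [(Finset.mem_filter.1 hi).2]
    ring
  have h2 : ∑ i with κ i = k, sgn (σ i) * (if Λ (κ i) then v j i else u j i)
      = if Λ k then B k else A k := by
    have h3 : ∀ i ∈ Finset.univ.filter (fun i => κ i = k),
        sgn (σ i) * (if Λ (κ i) then v j i else u j i)
          = if Λ k then sgn (σ i) * v j i else sgn (σ i) * u j i := by
      intro i hi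
      rw [(Finset.mem_filter.1 hi).2, mul_ite]
    rw [Finset.sum_congr rfl h3]
    by_cases h : Λ k <;> simp [h, A, B]
  rw [h1]
  refine le_trans ?_ h2.ge
  have h0 := (a j k).2.1
  have h1' := (a j k).2.2
  by_cases h : A k ≤ B k
  · simp only [Λ, h, decide_true, if_true]
    nlinarith
  · simp only [Λ, h, decide_false, Bool.false_eq_true, if_false]
    nlinarith

/-- The Rademacher average of the scores of interpolated models on a fixed sample. At each level,
a vertex model has a pattern determined by one central pattern and, for each client, either no
local pattern or one. -/
lemma rademacher_interpolate_le [Finite J] [Nonempty J] [Nonempty ι] (κ : ι → K) (S : ι → Z)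
    (Fc Fl : Set (Z → ℝ)) {dc dl : ℕ} (hdc : pseudoDim Fc = dc) (hdl : pseudoDim Fl = dl)
    (hdl_pos : 1 ≤ dl) (hdc_le : dc ≤ Fintype.card ι) (hdl_le : dl ≤ Fintype.card ι)
    (a : J → K → unitInterval) (fc : J → Z → ℝ) (fl : J → K → Z → ℝ) (hfc : ∀ j, fc j ∈ Fc)
    (hfl : ∀ j k, fl j k ∈ Fl) (hfc01 : ∀ j z, fc j z ∈ Set.Icc (0 : ℝ) 1)
    (hfl01 : ∀ j k z, fl j k z ∈ Set.Icc (0 : ℝ) 1) :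
    rademacher (fun j i => (1 - (a j (κ i) : ℝ)) * fc j (S i)
        + (a j (κ i) : ℝ) * fl j (κ i) (S i))
      ≤ √(2 * (dc * Real.log (Real.exp 1 * (Fintype.card ι : ℕ) / dc)
          + 2 * (Fintype.card K * (dl * Real.log (Real.exp 1 * (Fintype.card ι : ℕ) / dl))))
        * ((Fintype.card ι : ℕ) / 4)) := by
  classical
  refine (rademacher_interpolate_le_vertices κ a (fun j i => fc j (S i))
    fun j i => fl j (κ i) (S i)).trans ?_
  refine rademacher_le_of_threshold _ (fun q i => ?_) fun t => ?_
  · split_ifs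
    exacts [hfl01 _ _ _, hfc01 _ _]
  set m := Fintype.card ι with hm
  have hmpos : 0 < m := Fintype.card_pos
  have hKpos : 0 < Fintype.card K := Fintype.card_pos_iff.2 ⟨κ (Classical.arbitrary ι)⟩
  set Pc := thresholdPatterns Fc S t with hPc
  set Pl := thresholdPatterns Fl S t with hPl
  set code : Finset ι × (K → Option (Finset ι)) → ι → ℝ :=
    fun q i => if i ∈ (q.2 (κ i)).getD q.1 then (1 / 2 : ℝ) else -1 / 2 with hcode
  set codes := Pc ×ˢ Fintype.piFinset fun _ : K => Finset.insertNone Pl with hcodes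
  have hBl := one_le_mul_log hdl_pos hdl_le
  have hBc := mul_log_nonneg hdc_le
  have hmemc (j : J) : (Finset.univ.filter fun i => t < fc j (S i)) ∈ Pc := by
    simp only [hPc, thresholdPatterns, Finset.mem_filter, Finset.mem_univ, true_and]
    exact ⟨fc j, hfc j, fun i => Iff.rfl⟩
  have hmeml (j : J) (k : K) : (Finset.univ.filter fun i => t < fl j k (S i)) ∈ Pl := by
    simp only [hPl, thresholdPatterns, Finset.mem_filter, Finset.mem_univ, true_and]
    exact ⟨fl j k, hfl j k, fun i => Iff.rfl⟩
  refine rademacher_le_sqrt _ (codes.image code) (fun q => ?_) (by positivity)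
    (by have : (1 : ℝ) ≤ Fintype.card K := by exact_mod_cast hKpos
        nlinarith) (fun w hw => ?_) ?_
  · refine Finset.mem_image.2 ⟨⟨Finset.univ.filter fun i => t < fc q.1 (S i), fun k =>
      if q.2 k then some (Finset.univ.filter fun i => t < fl q.1 k (S i)) else none⟩, ?_, ?_⟩
    · refine Finset.mem_product.2 ⟨hmemc _, Fintype.mem_piFinset.2 fun k => ?_⟩
      dsimp only
      split_ifs
      · exact Finset.some_mem_insertNone.2 (hmeml _ _)
      · exact Finset.none_mem_insertNone
    · ext i
      by_cases h : q.2 (κ i) <;> simp [hcode, h]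
  · obtain ⟨q, -, rfl⟩ := Finset.mem_image.1 hw
    have h (i : ι) : code q i ^ 2 = 1 / 4 := by
      simp only [hcode]; split_ifs <;> norm_num
    simp [h, hm, div_eq_mul_inv]
  · have hcpos : 0 < (codes.image code).card := by
      obtain ⟨j⟩ := ‹Nonempty J›
      refine Finset.card_pos.2 ⟨_, Finset.mem_image_of_mem code (a := ⟨_, fun _ => none⟩)
        (Finset.mem_product.2 ⟨hmemc j, Fintype.mem_piFinset.2 fun k => ?_⟩)⟩
      exact Finset.none_mem_insertNone
    have hcard : (codes.image code).card ≤ Pc.card * (Pl.card + 1) ^ Fintype.card K := by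
      refine Finset.card_image_le.trans_eq ?_
      simp [hcodes, Finset.card_product]
    have hPcpos : 0 < Pc.card := Finset.card_pos.2 ⟨_, hmemc (Classical.arbitrary J)⟩
    calc Real.log (codes.image code).card
        ≤ Real.log ((Pc.card : ℝ) * ((Pl.card + 1 : ℕ) : ℝ) ^ Fintype.card K) := by
          refine Real.log_le_log (by exact_mod_cast hcpos) ?_
          exact_mod_cast hcard
      _ = Real.log Pc.card + Fintype.card K * Real.log (Pl.card + 1 : ℕ) := by
          rw [Real.log_mul (by positivity) (by positivity), Real.log_pow]
      _ ≤ _ := by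
          have h1 := log_card_thresholdPatterns_le Fc S t hdc hdc_le
          have h2 := log_succ_le_two_mul hBl (log_card_thresholdPatterns_le Fl S t hdl hdl_le)
          have h3 := mul_le_mul_of_nonneg_left h2 (Nat.cast_nonneg (α := ℝ) (Fintype.card K))
          linarith

end Interpolation

/-! ### Uniform deviations -/

section Concentration

variable {ι Z : Type*} [Fintype ι] [DecidableEq ι] [MeasurableSpace Z]

lemma abs_iSup_sub_iSup_le {J : Type*} [Finite J] [Nonempty J] {x y : J → ℝ} {c : ℝ}
    (h : ∀ j, |x j - y j| ≤ c) : |(⨆ j, x j) - ⨆ j, y j| ≤ c := by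
  obtain ⟨j, hj⟩ := exists_eq_ciSup_of_finite (f := x)
  obtain ⟨k, hk⟩ := exists_eq_ciSup_of_finite (f := y)
  have h1 : y j ≤ ⨆ j, y j := le_ciSup (Set.finite_range y).bddAbove j
  have h2 : x k ≤ ⨆ j, x j := le_ciSup (Set.finite_range x).bddAbove k
  have h3 := abs_le.1 (h j)
  have h4 := abs_le.1 (h k)
  rw [← hj, ← hk] at *
  exact abs_le.2 ⟨by linarith [h4.1], by linarith [h3.2]⟩

/-- With probability at least `1 - δ`, all the deviations of a finite family, corrected by the
deviation of a fixed competitor `f₀`, are at most twice the Rademacher bound plus a fluctuation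
term. Changing one example changes the corrected supremum by at most `2`. -/
lemma measure_exists_deviation_le_of_finite [Nonempty ι] {J : Type*} [Finite J] [Nonempty J]
    (ν : ι → Measure Z) [∀ i, IsProbabilityMeasure (ν i)] (f : J → ι → Z → ℝ) (f₀ : ι → Z → ℝ)
    (hf : ∀ j i, Measurable (f j i)) (hf01 : ∀ j i z, f j i z ∈ Set.Icc (0 : ℝ) 1)
    (hf₀ : ∀ i, Measurable (f₀ i)) (hf₀01 : ∀ i z, f₀ i z ∈ Set.Icc (0 : ℝ) 1) {R : ℝ}
    (hR : ∀ S : ι → Z, rademacher (fun j i => f j i (S i)) ≤ R) {δ : ℝ} (hδ : 0 < δ)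
    (hδ1 : δ < 1) :
    Measure.pi ν {S | ∃ j, 2 * R + 2 * √(Fintype.card ι * Real.log (1 / δ))
        < ∑ i, (∫ z, f j i z ∂ν i - f j i (S i)) + ∑ i, (f₀ i (S i) - ∫ z, f₀ i z ∂ν i)}
      ≤ ENNReal.ofReal δ := by
  set N : ℝ := (Fintype.card ι : ℝ) with hN
  have hNpos : 0 < N := by
    rw [hN]
    exact_mod_cast Fintype.card_pos
  have hlog : 0 < Real.log (1 / δ) := Real.log_pos ((one_lt_div hδ).2 hδ1)
  have hdiff {x y : ℝ} (hx : x ∈ Set.Icc (0 : ℝ) 1) (hy : y ∈ Set.Icc (0 : ℝ) 1) :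
      |x - y| ≤ 1 := abs_le.2 ⟨by linarith [hx.1, hy.2], by linarith [hx.2, hy.1]⟩
  have hmean {g : Z → ℝ} (i : ι) (hg : Measurable g) (hg01 : ∀ z, g z ∈ Set.Icc (0 : ℝ) 1) :
      Integrable g (ν i) ∧ ∫ z, g z ∂ν i ∈ Set.Icc (0 : ℝ) 1 := by
    have hint : Integrable g (ν i) :=
      Integrable.of_mem_Icc 0 1 hg.aemeasurable (Eventually.of_forall hg01)
    exact ⟨hint, integral_nonneg fun z => (hg01 z).1,
      (integral_mono hint (integrable_const 1) fun z => (hg01 z).2).trans (by simp)⟩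
  set Φ : (ι → Z) → ℝ := fun S => ⨆ j, ∑ i, (∫ z, f j i z ∂ν i - f j i (S i)) with hΦ
  set Ψ : (ι → Z) → ℝ := fun S => ∑ i, (f₀ i (S i) - ∫ z, f₀ i z ∂ν i) with hΨ
  have hΦm : Measurable Φ := Measurable.iSup fun j => Finset.measurable_fun_sum _ fun i _ =>
    measurable_const.sub ((hf j i).comp (measurable_pi_apply i))
  have hΨm : Measurable Ψ := Finset.measurable_fun_sum _ fun i _ =>
    ((hf₀ i).comp (measurable_pi_apply i)).sub measurable_const
  have hΦb (S : ι → Z) : |Φ S| ≤ N := by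
    refine abs_iSup_le_of_abs_le fun j => (Finset.abs_sum_le_sum_abs _ _).trans ?_
    refine (Finset.sum_le_sum fun i _ =>
      hdiff (hmean i (hf j i) (hf01 j i)).2 (hf01 j i (S i))).trans_eq ?_
    simp [hN]
  have hΨb (S : ι → Z) : |Ψ S| ≤ N := by
    refine (Finset.abs_sum_le_sum_abs _ _).trans ((Finset.sum_le_sum fun i _ =>
      hdiff (hf₀01 i (S i)) (hmean i (hf₀ i) (hf₀01 i)).2).trans_eq ?_)
    simp [hN]
  have hΦint : Integrable Φ (Measure.pi ν) :=
    Integrable.of_bound hΦm.aestronglyMeasurable N (Eventually.of_forall hΦb)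
  have hΨint : Integrable Ψ (Measure.pi ν) :=
    Integrable.of_bound hΨm.aestronglyMeasurable N (Eventually.of_forall hΨb)
  have hEΨ : ∫ S, Ψ S ∂Measure.pi ν = 0 := by
    have h1 (i : ι) : Integrable (fun S : ι → Z => f₀ i (S i)) (Measure.pi ν) :=
      (measurePreserving_eval ν i).integrable_comp_of_integrable (hmean i (hf₀ i) (hf₀01 i)).1
    have h2 (i : ι) :
        Integrable (fun S : ι → Z => f₀ i (S i) - ∫ z, f₀ i z ∂ν i) (Measure.pi ν) :=
      (h1 i).sub (integrable_const _)
    rw [hΨ, integral_finsetSum _ fun i _ => h2 i]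
    refine Finset.sum_eq_zero fun i _ => ?_
    have h3 := integral_comp_eval (μ := ν) (i := i) (f := f₀ i) (hf₀ i).aestronglyMeasurable
    rw [integral_sub (h1 i) (integrable_const _), h3]
    simp
  have hE : ∫ S, (Φ S + Ψ S) ∂Measure.pi ν ≤ 2 * R := by
    rw [integral_add hΦint hΨint, hEΨ, add_zero]
    exact integral_iSup_sub_le_of_rademacher_le ν f hf hf01 hR
  have hsum_update (g : ι → Z → ℝ) (S : ι → Z) (i : ι) (z : Z) :
      ∑ k, g k (S k) - ∑ k, g k (Function.update S i z k) = g i (S i) - g i z := by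
    rw [← Finset.sum_sub_distrib, Finset.sum_eq_single i]
    · rw [Function.update_self]
    · intro k _ hk
      rw [Function.update_of_ne hk, sub_self]
    · simp
  have hbd (S : ι → Z) (i : ι) (z : Z) :
      |(Φ S + Ψ S) - (Φ (Function.update S i z) + Ψ (Function.update S i z))| ≤ 2 := by
    have h1 : |Φ S - Φ (Function.update S i z)| ≤ 1 := by
      refine abs_iSup_sub_iSup_le fun j => ?_
      rw [hsum_update (fun i z' => ∫ z, f j i z ∂ν i - f j i z') S i z, sub_sub_sub_cancel_left]
      exact hdiff (hf01 _ _ _) (hf01 _ _ _)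
    have h2 : |Ψ S - Ψ (Function.update S i z)| ≤ 1 := by
      rw [hΨ]
      dsimp only
      rw [hsum_update (fun i z' => f₀ i z' - ∫ z, f₀ i z ∂ν i) S i z, sub_sub_sub_cancel_right]
      exact hdiff (hf₀01 _ _) (hf₀01 _ _)
    rw [add_sub_add_comm]
    exact (abs_add_le _ _).trans (by linarith)
  set t := 2 * √(N * Real.log (1 / δ)) with ht
  have hmcd := measure_ge_le_of_boundedDifferences ν (fun S => Φ S + Ψ S) (hΦm.add hΨm)
    (C := 2 * N) (fun S => (abs_add_le _ _).trans (by linarith [hΦb S, hΨb S])) (fun _ => 2) hbd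
    (by simp [Fintype.card_pos]) (t := t) (by positivity)
  -- This choice of `t` gives probability at most `δ ^ 2`.
  have hexp : Real.exp (-(2 * t ^ 2 / ∑ _i : ι, (2 : ℝ) ^ 2)) ≤ δ := by
    have h1 : t ^ 2 = 4 * (N * Real.log (1 / δ)) := by
      rw [ht, mul_pow, Real.sq_sqrt (by positivity)]
      norm_num
    have h2 : ∑ _i : ι, (2 : ℝ) ^ 2 = 4 * N := by
      simp [hN]; ring
    have h3 : -(2 * t ^ 2 / ∑ _i : ι, (2 : ℝ) ^ 2) = -(2 * Real.log (1 / δ)) := by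
      rw [h1, h2]
      field_simp
    rw [h3, one_div, Real.log_inv]
    rw [one_div, Real.log_inv] at hlog
    calc Real.exp (-(2 * -Real.log δ)) ≤ Real.exp (Real.log δ) :=
          Real.exp_le_exp.2 (by linarith)
      _ = δ := Real.exp_log hδ
  refine (measure_mono fun S hS => ?_).trans
    ((ENNReal.le_ofReal_iff_toReal_le (measure_ne_top _ _) hδ.le).2 (hmcd.trans hexp))
  obtain ⟨j, hj⟩ := hS
  have h1 : ∑ i, (∫ z, f j i z ∂ν i - f j i (S i)) ≤ Φ S :=
    le_ciSup (f := fun j => ∑ i, (∫ z, f j i z ∂ν i - f j i (S i)))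
      (Set.finite_range _).bddAbove j
  change ∫ S', (Φ S' + Ψ S') ∂Measure.pi ν + t ≤ Φ S + Ψ S
  linarith

/-- The version for countable families, by exhaustion with finite subfamilies. -/
lemma measure_exists_deviation_le_of_countable [Nonempty ι] {J : Type*} [Countable J]
    (ν : ι → Measure Z) [∀ i, IsProbabilityMeasure (ν i)] (f : J → ι → Z → ℝ) (f₀ : ι → Z → ℝ)
    (hf : ∀ j i, Measurable (f j i)) (hf01 : ∀ j i z, f j i z ∈ Set.Icc (0 : ℝ) 1)
    (hf₀ : ∀ i, Measurable (f₀ i)) (hf₀01 : ∀ i z, f₀ i z ∈ Set.Icc (0 : ℝ) 1) {R : ℝ}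
    (hR : ∀ s : Finset J, s.Nonempty → ∀ S : ι → Z,
      rademacher (fun (j : s) i => f j i (S i)) ≤ R)
    {δ : ℝ} (hδ : 0 < δ) (hδ1 : δ < 1) :
    Measure.pi ν {S | ∃ j, 2 * R + 2 * √(Fintype.card ι * Real.log (1 / δ))
        < ∑ i, (∫ z, f j i z ∂ν i - f j i (S i)) + ∑ i, (f₀ i (S i) - ∫ z, f₀ i z ∂ν i)}
      ≤ ENNReal.ofReal δ := by
  classical
  set A : Finset J → Set (ι → Z) := fun s => {S | ∃ j : s,
    2 * R + 2 * √(Fintype.card ι * Real.log (1 / δ))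
      < ∑ i, (∫ z, f j i z ∂ν i - f j i (S i)) + ∑ i, (f₀ i (S i) - ∫ z, f₀ i z ∂ν i)} with hA
  have hmono : Monotone A := fun s t hst S ⟨j, hj⟩ => ⟨⟨j, hst j.2⟩, hj⟩
  refine (measure_mono (t := ⋃ s, A s) ?_).trans ?_
  · rintro S ⟨j, hj⟩
    exact Set.mem_iUnion.2 ⟨{j}, ⟨j, Finset.mem_singleton_self j⟩, hj⟩
  rw [hmono.measure_iUnion]
  refine iSup_le fun s => ?_
  rcases s.eq_empty_or_nonempty with rfl | hs
  · have : A ∅ = ∅ := Set.eq_empty_of_forall_notMem fun S ⟨j, _⟩ => Finset.notMem_empty _ j.2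
    simp [this]
  · have : Nonempty s := hs.to_subtype
    exact measure_exists_deviation_le_of_finite ν (fun (j : s) => f j) f₀ (fun j => hf j)
      (fun j => hf01 j) hf₀ hf₀01 (hR s hs) hδ hδ1

end Concentration

/-! ### Interpolated models and their risks -/

section Models

variable {X Y : Type*} [Fintype Y]

lemma stdSimplex_apply_mem_Icc (u : stdSimplex ℝ Y) (y : Y) : (u : Y → ℝ) y ∈ Set.Icc (0 : ℝ) 1 :=
  mem_Icc_of_mem_stdSimplex u.2 y

lemma LossLipschitz.tendsto {L : ℝ} {loss : stdSimplex ℝ Y → Y → ℝ} (hlip : LossLipschitz L loss)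
    {α : Type*} {l : Filter α} {u : α → stdSimplex ℝ Y} {v : stdSimplex ℝ Y} (y : Y)
    (h : Tendsto (fun n => (u n : Y → ℝ) y) l (𝓝 ((v : Y → ℝ) y))) :
    Tendsto (fun n => loss (u n) y) l (𝓝 (loss v y)) := by
  rw [tendsto_iff_dist_tendsto_zero] at h ⊢
  refine squeeze_zero (fun _ => dist_nonneg) (fun n => ?_) (by simpa using h.const_mul L)
  exact hlip (u n) v y

lemma LossLipschitz.measurable [MeasurableSpace X] [MeasurableSpace Y] [MeasurableSingletonClass Y]
    {L : ℝ} {loss : stdSimplex ℝ Y → Y → ℝ} (hlip : LossLipschitz L loss) {h : Hypothesis X Y}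
    (hh : Measurable h) : Measurable fun z : X × Y => loss (h z.1) z.2 := by
  refine measurable_from_prod_countable_left fun y => ?_
  have hcont : Continuous fun u : stdSimplex ℝ Y => loss u y :=
    continuous_iff_continuousAt.2 fun v => hlip.tendsto y
      (((continuous_apply y).comp continuous_subtype_val).tendsto v)
  exact hcont.measurable.comp hh

lemma measurable_interpolate [MeasurableSpace X] (a : unitInterval) {hc hl : Hypothesis X Y}
    (hhc : Measurable hc) (hhl : Measurable hl) : Measurable (interpolate a hc hl) := by
  refine Measurable.subtype_mk ?_
  have h1 : Measurable fun x => (hc x : Y → ℝ) := measurable_subtype_coe.comp hhc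
  have h2 : Measurable fun x => (hl x : Y → ℝ) := measurable_subtype_coe.comp hhl
  exact (h1.const_smul (1 - (a : ℝ))).add (h2.const_smul (a : ℝ))

lemma measurable_predictor [MeasurableSpace X] {p : ℕ} {Hc Hl : Set (Hypothesis X Y)}
    (hHc : PointwiseMeasurable Hc) (hHl : PointwiseMeasurable Hl) {θ : Model p X Y}
    (hθ : θ ∈ modelClass p Hc Hl) (k : Fin p) : Measurable (θ.predictor k) :=
  measurable_interpolate _ (hHc.1 _ hθ.1) (hHl.1 _ (hθ.2 k))

/-- Countably many models suffice: those with hypotheses in the countable subclasses and weights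
in a countable dense subset of the unit interval approximate every model pointwise. -/
lemma exists_countable_models [MeasurableSpace X] (p : ℕ) {Hc Hl : Set (Hypothesis X Y)}
    (hHc : PointwiseMeasurable Hc) (hHl : PointwiseMeasurable Hl) :
    ∃ C ⊆ modelClass p Hc Hl, C.Countable ∧ ∀ θ ∈ modelClass p Hc Hl, ∃ u : ℕ → Model p X Y,
      (∀ n, u n ∈ C) ∧ ∀ k x y, Tendsto (fun n => ((u n).predictor k x : Y → ℝ) y) atTop
        (𝓝 ((θ.predictor k x : Y → ℝ) y)) := by
  obtain ⟨-, C₀, hC₀, hC₀c, hC₀d⟩ := hHc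
  obtain ⟨-, L₀, hL₀, hL₀c, hL₀d⟩ := hHl
  obtain ⟨W, hWc, hWd⟩ := TopologicalSpace.exists_countable_dense unitInterval
  have := hC₀c.to_subtype
  have := hL₀c.to_subtype
  have := hWc.to_subtype
  let mk : C₀ × (Fin p → W) × (Fin p → L₀) → Model p X Y :=
    fun q => ⟨q.1, fun k => q.2.1 k, fun k => q.2.2 k⟩
  refine ⟨Set.range mk, ?_, Set.countable_range mk, fun θ hθ => ?_⟩
  · rintro _ ⟨q, rfl⟩
    exact ⟨hC₀ q.1.2, fun k => hL₀ (q.2.2 k).2⟩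
  · obtain ⟨c, hc, hct⟩ := hC₀d _ hθ.1
    choose l hl hlt using fun k => hL₀d _ (hθ.2 k)
    choose w hw hwt using fun k => mem_closure_iff_seq_limit.1 (hWd (θ.weight k))
    refine ⟨fun n => mk (⟨c n, hc n⟩, fun k => ⟨w k n, hw k n⟩, fun k => ⟨l k n, hl k n⟩),
      fun n => ⟨_, rfl⟩, fun k x y => ?_⟩
    have hcoe {u : ℕ → stdSimplex ℝ Y} {v : stdSimplex ℝ Y} (h : Tendsto u atTop (𝓝 v)) :
        Tendsto (fun n => (u n : Y → ℝ) y) atTop (𝓝 ((v : Y → ℝ) y)) :=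
      (((continuous_apply y).comp continuous_subtype_val).tendsto v).comp h
    have hwt' : Tendsto (fun n => (w k n : ℝ)) atTop (𝓝 (θ.weight k : ℝ)) :=
      (continuous_subtype_val.tendsto _).comp (hwt k)
    exact ((hwt'.const_sub 1).mul (hcoe (hct x))).add (hwt'.mul (hcoe (hlt k x)))

variable {p : ℕ} {loss : stdSimplex ℝ Y → Y → ℝ}

/-- The loss of the model `θ` on an example of the client of the index `i`. -/
def exampleLoss (loss : stdSimplex ℝ Y → Y → ℝ) (m : Fin p → ℕ) (θ : Model p X Y)
    (i : (k : Fin p) × Fin (m k)) (z : X × Y) : ℝ :=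
  loss (θ.predictor i.1 z.1) z.2

lemma card_mul_totalRisk [MeasurableSpace X] [MeasurableSpace Y] (m : Fin p → ℕ)
    (D : Fin p → Measure (X × Y)) (θ : Model p X Y) (hm : 0 < ∑ k, m k) :
    ((∑ k, m k : ℕ) : ℝ) * totalRisk loss m D θ
      = ∑ i : (k : Fin p) × Fin (m k), ∫ z, exampleLoss loss m θ i z ∂D i.1 := by
  rw [totalRisk, Finset.mul_sum, Fintype.sum_sigma]
  refine Finset.sum_congr rfl fun k _ => ?_
  have : ((∑ k, m k : ℕ) : ℝ) ≠ 0 := by exact_mod_cast hm.ne'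
  simp only [exampleLoss, risk, Finset.sum_const, Finset.card_univ, Fintype.card_fin, nsmul_eq_mul]
  rw [← mul_assoc, mul_div_cancel₀ _ this]

lemma card_mul_totalEmpiricalRisk (m : Fin p → ℕ) (S : ∀ k, Fin (m k) → X × Y)
    (θ : Model p X Y) (hm : 0 < ∑ k, m k) :
    ((∑ k, m k : ℕ) : ℝ) * totalEmpiricalRisk loss m S θ
      = ∑ i : (k : Fin p) × Fin (m k), exampleLoss loss m θ i (S i.1 i.2) := by
  rw [totalEmpiricalRisk, Finset.mul_sum, Fintype.sum_sigma]
  refine Finset.sum_congr rfl fun k _ => ?_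
  have : ((∑ k, m k : ℕ) : ℝ) ≠ 0 := by exact_mod_cast hm.ne'
  rw [← mul_assoc, mul_div_cancel₀ _ this, empiricalRisk]
  -- A client without examples contributes the empty sum.
  rcases Nat.eq_zero_or_pos (m k) with h | h
  · have : IsEmpty (Fin (m k)) := by rw [h]; infer_instance
    simp [h]
  · have h' : (m k : ℝ) ≠ 0 := by exact_mod_cast h.ne'
    rw [mul_div_cancel₀ _ h']
    rfl

lemma rademacher_const_mul {ι J : Type*} [Fintype ι] [DecidableEq ι] (v : J → ι → ℝ) {L : ℝ}
    (hL : 0 ≤ L) : rademacher (fun j i => L * v j i) = L * rademacher v := by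
  simp only [rademacher, Finset.mul_expect, Real.mul_iSup_of_nonneg hL, Finset.mul_sum]
  simp only [mul_left_comm]

/-- The Rademacher average of the losses, by contraction to the scores of the labels. -/
lemma rademacher_exampleLoss_le {J : Type*} [Finite J] [Nonempty J] (m : Fin p → ℕ) {L : ℝ}
    (hL : 0 ≤ L) (hlip : LossLipschitz L loss) {Hc Hl : Set (Hypothesis X Y)} {dc dl : ℕ}
    (hdc : pseudoDim (scoreClass Hc) = dc) (hdl : pseudoDim (scoreClass Hl) = dl)
    (hdl_pos : 1 ≤ dl) (hdc_le : dc ≤ ∑ k, m k) (hdl_le : dl ≤ ∑ k, m k)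
    (θ : J → Model p X Y) (hθ : ∀ j, θ j ∈ modelClass p Hc Hl)
    (S : (k : Fin p) × Fin (m k) → X × Y) :
    rademacher (fun j i => exampleLoss loss m (θ j) i (S i))
      ≤ L * √(2 * (dc * Real.log (Real.exp 1 * (∑ k, m k : ℕ) / dc)
          + 2 * (p * (dl * Real.log (Real.exp 1 * (∑ k, m k : ℕ) / dl))))
        * ((∑ k, m k : ℕ) / 4)) := by
  have hcard : Fintype.card ((k : Fin p) × Fin (m k)) = ∑ k, m k := by simp
  have : Nonempty ((k : Fin p) × Fin (m k)) :=
    Fintype.card_pos_iff.1 (by rw [hcard]; omega)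
  let score (h : Hypothesis X Y) (z : X × Y) : ℝ := (h z.1 : Y → ℝ) z.2
  have hbound := rademacher_interpolate_le (fun i : (k : Fin p) × Fin (m k) => i.1) S
    (scoreClass Hc) (scoreClass Hl) hdc hdl hdl_pos (by rwa [hcard]) (by rwa [hcard])
    (fun j => (θ j).weight) (fun j => score (θ j).central) (fun j k => score ((θ j).localHyp k))
    (fun j => ⟨_, (hθ j).1, rfl⟩) (fun j k => ⟨_, (hθ j).2 k, rfl⟩)
    (fun j z => stdSimplex_apply_mem_Icc _ _) (fun j k z => stdSimplex_apply_mem_Icc _ _)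
  rw [hcard, Fintype.card_fin] at hbound
  refine le_trans ?_ (mul_le_mul_of_nonneg_left hbound hL)
  rw [← rademacher_const_mul _ hL]
  refine rademacher_le_of_abs_sub_le _ _ fun i j j' => ?_
  rw [← mul_sub, abs_mul, abs_of_nonneg hL]
  exact hlip _ _ _

/-- The law of the samples is a product over all examples. -/
lemma sampleLaw_eq_map {X Y : Type*} {p : ℕ} [MeasurableSpace X] [MeasurableSpace Y] (m : Fin p → ℕ)
    (D : Fin p → Measure (X × Y)) [∀ k, IsProbabilityMeasure (D k)] :
    sampleLaw m D = (Measure.pi fun i : (k : Fin p) × Fin (m k) => D i.1).map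
      (MeasurableEquiv.piCurry fun (k : Fin p) (_ : Fin (m k)) => X × Y) := by
  have h := Measure.infinitePi_map_piCurry (X := fun (k : Fin p) (_ : Fin (m k)) => X × Y)
    (fun (k : Fin p) (_ : Fin (m k)) => D k)
  simp only [Measure.infinitePi_eq_pi] at h
  exact h.symm

/-- The uniform deviation bound, multiplied by the number of examples, in terms of the bound on
the excess risk. The slack `(a + 2 b) / 2 ≤ (√a + √b) ^ 2` absorbs the cost of choosing, for each
client, between the central and the local hypothesis. -/
lemma deviation_le_excessBound {L : ℝ} (hL : 0 ≤ L) {p N dc dl : ℕ} (hN : 0 < N)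
    (hdc_le : dc ≤ N) (hdl_le : dl ≤ N) {δ : ℝ} :
    2 * (L * √(2 * (dc * Real.log (Real.exp 1 * N / dc)
          + 2 * (p * (dl * Real.log (Real.exp 1 * N / dl)))) * ((N : ℝ) / 4)))
        + 2 * √(N * Real.log (1 / δ))
      ≤ N * excessBound L p N dc dl δ := by
  have hN0 : (0 : ℝ) < N := by exact_mod_cast hN
  have ha := mul_log_nonneg hdc_le
  have hb := mul_nonneg (Nat.cast_nonneg (α := ℝ) p) (mul_log_nonneg hdl_le)
  set A : ℝ := dc * Real.log (Real.exp 1 * N / dc) with hA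
  set B : ℝ := p * (dl * Real.log (Real.exp 1 * N / dl)) with hB
  have h1 : (dc : ℝ) / N * Real.log (Real.exp 1 * N / dc) = A / N := by rw [hA]; ring
  have h2 : (dl : ℝ) * p / N * Real.log (Real.exp 1 * N / dl) = B / N := by rw [hB]; ring
  have h3 : √(N * Real.log (1 / δ)) = N * √(Real.log (1 / δ) / N) := by
    rw [show (N : ℝ) * Real.log (1 / δ) = N ^ 2 * (Real.log (1 / δ) / N) by field_simp,
      Real.sqrt_mul (by positivity), Real.sqrt_sq hN0.le]
  have h4 : √(2 * (A + 2 * B) * (N / 4)) ≤ N * (√(A / N) + √(B / N)) := by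
    refine Real.sqrt_le_iff.2 ⟨by positivity, ?_⟩
    have h5 : √(A / N) ^ 2 = A / N := Real.sq_sqrt (by positivity)
    have h6 : √(B / N) ^ 2 = B / N := Real.sq_sqrt (by positivity)
    have h7 : 0 ≤ √(A / N) * √(B / N) := by positivity
    calc 2 * (A + 2 * B) * (N / 4) ≤ N ^ 2 * (A / N + B / N) := by
          field_simp
          nlinarith
      _ = (N : ℝ) ^ 2 * (√(A / N) ^ 2 + √(B / N) ^ 2) := by rw [h5, h6]
      _ ≤ (N * (√(A / N) + √(B / N))) ^ 2 := by
          rw [mul_pow]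
          refine mul_le_mul_of_nonneg_left ?_ (by positivity)
          nlinarith
  rw [excessBound, h1, h2, h3]
  have := mul_le_mul_of_nonneg_left h4 hL
  nlinarith

end Models

end ModelInterpolation

end

theorem mainTheorem5 {X Y : Type*} [MeasurableSpace X] [Fintype Y] [MeasurableSpace Y]
    [MeasurableSingletonClass Y]
    (p : ℕ) (m : Fin p → ℕ)
    (D : Fin p → Measure (X × Y)) [∀ k, IsProbabilityMeasure (D k)]
    (loss : stdSimplex ℝ Y → Y → ℝ) (hbdd : ModelInterpolation.LossBounded loss)
    (L : ℝ) (hL : 0 ≤ L) (hlip : ModelInterpolation.LossLipschitz L loss)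
    (Hc Hl : Set (ModelInterpolation.Hypothesis X Y))
    (hHc : ModelInterpolation.PointwiseMeasurable Hc)
    (hHl : ModelInterpolation.PointwiseMeasurable Hl)
    (dc dl : ℕ)
    (hdc : ModelInterpolation.pseudoDim (ModelInterpolation.scoreClass Hc) = (dc : ℕ∞))
    (hdl : ModelInterpolation.pseudoDim (ModelInterpolation.scoreClass Hl) = (dl : ℕ∞))
    (hdl_pos : 1 ≤ dl) (hdc_le : dc ≤ ∑ k, m k) (hdl_le : dl ≤ ∑ k, m k)
    (θopt : ModelInterpolation.Model p X Y)
    (hopt : ModelInterpolation.IsOptimal (ModelInterpolation.modelClass p Hc Hl)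
      (ModelInterpolation.totalRisk loss m D) θopt)
    (δ : ℝ) (hδ : 0 < δ) (hδ1 : δ < 1) :
    ModelInterpolation.sampleLaw m D
      {S | ¬ ∀ θhat : ModelInterpolation.Model p X Y,
        ModelInterpolation.IsOptimal (ModelInterpolation.modelClass p Hc Hl)
          (ModelInterpolation.totalEmpiricalRisk loss m S) θhat →
        ModelInterpolation.totalRisk loss m D θhat
            - ModelInterpolation.totalRisk loss m D θopt
          ≤ ModelInterpolation.excessBound L p (∑ k, m k) dc dl δ}
      ≤ ENNReal.ofReal δ := by
  open ModelInterpolation in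
  have hN : 0 < ∑ k, m k := by omega
  have hcard : Fintype.card ((k : Fin p) × Fin (m k)) = ∑ k, m k := by simp
  have : Nonempty ((k : Fin p) × Fin (m k)) := Fintype.card_pos_iff.1 (by rw [hcard]; exact hN)
  obtain ⟨C, hC, hCc, hCd⟩ := exists_countable_models p hHc hHl
  have := hCc.to_subtype
  have hmeas {θ : Model p X Y} (hθ : θ ∈ modelClass p Hc Hl) (i : (k : Fin p) × Fin (m k)) :
      Measurable (exampleLoss loss m θ i) :=
    hlip.measurable (measurable_predictor hHc hHl hθ i.1)
  have h01 (θ : Model p X Y) (i : (k : Fin p) × Fin (m k)) (z : X × Y) :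
      exampleLoss loss m θ i z ∈ Set.Icc (0 : ℝ) 1 := hbdd _ _
  have hdev := measure_exists_deviation_le_of_countable
    (fun i : (k : Fin p) × Fin (m k) => D i.1)
    (fun (θ : C) => exampleLoss loss m θ.1) (exampleLoss loss m θopt)
    (fun θ i => hmeas (hC θ.2) i) (fun θ => h01 θ.1) (fun i => hmeas hopt.1 i) (h01 θopt)
    (fun s hs S => by
      have : Nonempty s := hs.to_subtype
      exact rademacher_exampleLoss_le m hL hlip hdc hdl hdl_pos hdc_le hdl_le
        (fun j : s => (j : C).1) (fun j => hC (j : C).2) S) hδ hδ1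
  rw [sampleLaw_eq_map, MeasurableEquiv.map_apply]
  refine (measure_mono fun S hS => ?_).trans hdev
  obtain ⟨θhat, hθhat⟩ := not_forall.1 hS
  obtain ⟨hmin, hviol⟩ := Classical.not_imp.1 hθhat
  rw [not_le] at hviol
  -- The competitor cannot have a smaller empirical risk than the empirical minimizer.
  have hemp := hmin.2 hopt.1
  obtain ⟨u, hu, hut⟩ := hCd θhat hmin.1
  have hloss (i : (k : Fin p) × Fin (m k)) (z : X × Y) :
      Tendsto (fun n => exampleLoss loss m (u n) i z) atTop (𝓝 (exampleLoss loss m θhat i z)) :=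
    hlip.tendsto z.2 (hut i.1 z.1 z.2)
  have hint (i : (k : Fin p) × Fin (m k)) :
      Tendsto (fun n => ∫ z, exampleLoss loss m (u n) i z ∂D i.1) atTop
        (𝓝 (∫ z, exampleLoss loss m θhat i z ∂D i.1)) := by
    refine tendsto_integral_of_dominated_convergence (fun _ => 1)
      (fun n => (hmeas (hC (hu n)) i).aestronglyMeasurable) (integrable_const 1)
      (fun n => Eventually.of_forall fun z => ?_) (Eventually.of_forall fun z => hloss i z)
    rw [Real.norm_eq_abs, abs_of_nonneg (h01 _ _ _).1]
    exact (h01 _ _ _).2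
  have hlim : Tendsto (fun n => ∑ i, (∫ z, exampleLoss loss m (u n) i z ∂D i.1
        - exampleLoss loss m (u n) i (S i))) atTop
      (𝓝 (∑ i, (∫ z, exampleLoss loss m θhat i z ∂D i.1 - exampleLoss loss m θhat i (S i)))) :=
    tendsto_finsetSum _ fun i _ => (hint i).sub (hloss i (S i))
  have hlt : 2 * (L * √(2 * (dc * Real.log (Real.exp 1 * (∑ k, m k : ℕ) / dc)
          + 2 * (p * (dl * Real.log (Real.exp 1 * (∑ k, m k : ℕ) / dl))))
            * (((∑ k, m k : ℕ) : ℝ) / 4)))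
        + 2 * √(((∑ k, m k : ℕ) : ℝ) * Real.log (1 / δ))
      < ∑ i, (∫ z, exampleLoss loss m θhat i z ∂D i.1 - exampleLoss loss m θhat i (S i))
        + ∑ i, (exampleLoss loss m θopt i (S i) - ∫ z, exampleLoss loss m θopt i z ∂D i.1) := by
    refine (deviation_le_excessBound hL hN hdc_le hdl_le).trans_lt ?_
    set S' := MeasurableEquiv.piCurry (fun (k : Fin p) (_ : Fin (m k)) => X × Y) S with hS'
    have e1 := card_mul_totalRisk (loss := loss) m D θhat hN
    have e2 := card_mul_totalRisk (loss := loss) m D θopt hN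
    have e3 : _ = ∑ i, exampleLoss loss m θhat i (S i) :=
      card_mul_totalEmpiricalRisk (loss := loss) m S' θhat hN
    have e4 : _ = ∑ i, exampleLoss loss m θopt i (S i) :=
      card_mul_totalEmpiricalRisk (loss := loss) m S' θopt hN
    rw [Finset.sum_sub_distrib, Finset.sum_sub_distrib, ← e1, ← e2, ← e3, ← e4]
    have hN0 : (0 : ℝ) < (∑ k, m k : ℕ) := by exact_mod_cast hN
    have h1 := mul_lt_mul_of_pos_left hviol hN0
    have h2 : totalEmpiricalRisk loss m S' θhat ≤ totalEmpiricalRisk loss m S' θopt := hemp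
    have h3 := mul_le_mul_of_nonneg_left h2 hN0.le
    linarith
  obtain ⟨n, hn⟩ := ((hlim.add_const _).eventually (lt_mem_nhds hlt)).exists
  refine ⟨⟨u n, hu n⟩, ?_⟩
  rw [hcard]
  exact hn
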